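/- Let $n$ be a positive integer, let $\alpha=(\alpha_1,\dots,\alpha_m)$ be a composition of $n$ (a sequence of positive integers with sum $n$), and let $\mathfrak S_\alpha$ be the set of words $w=w_1w_2\cdots w_n$ that are rearrangements of the multiset $\{1^{\alpha_1},2^{\alpha_2},\dots,m^{\alpha_m}\}$. A letter $w_i$ is a weak right-to-left minimum of $w$ if $w_i\le w_j$ for all $j>i$; let $\mathsf{Rlwmin}(w)$ be the multiset of the weak right-to-left minima of $w$ (one element for each such position $i$). For a multiset $R$ let $\mathfrak S_{\alpha,R}=\{w\in\mathfrak S_\alpha:\mathsf{Rlwmin}(w)=R\}$. Let $r$ be a positive integer. For any word $u$ let $\mathsf{inv}(u)=|\{(i,j):i<j,\ u_i>u_j\}|$ and $\mathsf{imv}(u)=|\{(i,j):i<j,\ u_i\ge u_j\}|$. For $w\in\mathfrak S_\alpha$ with nondecreasing rearrangement $a_1a_2\cdots a_n$ put $$r\mathsf{Des}(w)=\{i\in\{1,\dots,n-1\}:w_i\ge w_{i+1}+r\},\qquad r\mathsf{des}(w)=|r\mathsf{Des}(w)|,$$ $$r\mathsf{maj}(w)=|\{(i,j):i<j,\ w_i>w_j>w_i-r\}|+\sum_{i\in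 r\mathsf{Des}(w)}i,$$ $$r\mathsf{Exc}(w)=\{i\in\{1,\dots,n\}:w_i\ge a_i+r\},\qquad r\mathsf{exc}(w)=|r\mathsf{Exc}(w)|,$$ $$r\mathsf{den}(w)=\sum_{i\in r\mathsf{Exc}(w)}\bigl(i+|\{j:w_i-r<a_j<w_i\}|\bigr)+\mathsf{imv}(r\mathsf{EXCL}(w))+\mathsf{inv}(r\mathsf{NEXCL}(w)),$$ where $r\mathsf{EXCL}(w)$ is the subsequence of $w$ formed by the letters $w_i$ with $i\in r\mathsf{Exc}(w)$, and $r\mathsf{NEXCL}(w)$ is the subsequence formed by the remaining letters. Theorem. For every composition $\alpha$ of $n$, every multiset $R$ and every positive integer $r$, $$\sum_{w\in\mathfrak S_{\alpha,R}}t^{\,r\mathsf{des}(w)}q^{\,r\mathsf{maj}(w)}=\sum_{w\in\mathfrak S_{\alpha,R}}t^{\,r\mathsf{exc}(w)}q^{\,r\mathsf{den}(w)}$$ as polynomials in the indeterminates $t$ and $q$. -/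

import Mathlib

open Finset

namespace RWord

/-- The letter `w_i` of the word `w = w_1 w_2 … w_n`, with positions counted from `1`.
It is only ever used at positions `1 ≤ i ≤ n`, so that the default value plays no role. -/
def letter (w : List ℕ) (i : ℕ) : ℕ := w.getD (i - 1) 0

/-- The multiset `{1^{α_1}, 2^{α_2}, …, m^{α_m}}` attached to the composition
`α = (α_1, …, α_m)` of `n`. -/
def content {n : ℕ} (α : Composition n) : Multiset ℕ :=
  ∑ i : Fin α.length, Multiset.replicate (α.blocksFun i) ((i : ℕ) + 1)

/-- The set `𝔖_α` of words that are rearrangements of `{1^{α_1}, …, m^{α_m}}`. -/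
def words {n : ℕ} (α : Composition n) : Finset (List ℕ) := (content α).lists.toFinset

/-- The multiset of weak right-to-left minima: the letters `w_i` with `w_i ≤ w_j` for all
`j > i` (no condition when `i = n`). -/
def Rlwmin (w : List ℕ) : Multiset ℕ :=
  ({i ∈ Icc 1 w.length | ∀ j ∈ Ioc i w.length, letter w i ≤ letter w j} : Finset ℕ).val.map
    (letter w)

/-- The set `𝔖_{α,R}` of the words in `𝔖_α` whose multiset of weak right-to-left minima
is `R`. -/
def wordsRlwmin {n : ℕ} (α : Composition n) (R : Multiset ℕ) : Finset (List ℕ) :=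
  {w ∈ words α | Rlwmin w = R}

/-- The number of inversions. -/
def inv (w : List ℕ) : ℕ :=
  #{p ∈ Icc 1 w.length ×ˢ Icc 1 w.length | p.1 < p.2 ∧ letter w p.1 > letter w p.2}

/-- The number of weak inversions. -/
def imv (w : List ℕ) : ℕ :=
  #{p ∈ Icc 1 w.length ×ˢ Icc 1 w.length | p.1 < p.2 ∧ letter w p.1 ≥ letter w p.2}

/-- The set of `r`-descents: positions `1 ≤ i ≤ n - 1` with `w_i ≥ w_{i+1} + r`. -/
def rDes (r : ℕ) (w : List ℕ) : Finset ℕ :=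
  {i ∈ Icc 1 (w.length - 1) | letter w i ≥ letter w (i + 1) + r}

/-- The number of `r`-descents. -/
def rdes (r : ℕ) (w : List ℕ) : ℕ := #(rDes r w)

/-- The set of pairs `i < j` with `w_i > w_j > w_i - r`; the second inequality is written
without subtraction. -/
def rInv (r : ℕ) (w : List ℕ) : Finset (ℕ × ℕ) :=
  {p ∈ Icc 1 w.length ×ˢ Icc 1 w.length |
    p.1 < p.2 ∧ letter w p.1 > letter w p.2 ∧ letter w p.2 + r > letter w p.1}

/-- The `r`-major index. -/
def rmaj (r : ℕ) (w : List ℕ) : ℕ := #(rInv r w) + ∑ i ∈ rDes r w, i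

/-- The nondecreasing rearrangement `a_1 a_2 … a_n` of `w`. -/
def rearr (w : List ℕ) : List ℕ := (w : Multiset ℕ).sort (· ≤ ·)

/-- The set of `r`-excedances: positions `i` with `w_i ≥ a_i + r`. -/
def rExc (r : ℕ) (w : List ℕ) : Finset ℕ :=
  {i ∈ Icc 1 w.length | letter w i ≥ letter (rearr w) i + r}

/-- The number of `r`-excedances. -/
def rexc (r : ℕ) (w : List ℕ) : ℕ := #(rExc r w)

/-- The subsequence of `w` consisting of the letters at the `r`-excedances. -/
def rEXCL (r : ℕ) (w : List ℕ) : List ℕ :=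
  ((List.range' 1 w.length).filter (fun i => i ∈ rExc r w)).map (letter w)

/-- The subsequence of `w` consisting of the remaining letters. -/
def rNEXCL (r : ℕ) (w : List ℕ) : List ℕ :=
  ((List.range' 1 w.length).filter (fun i => i ∉ rExc r w)).map (letter w)

/-- `B_i^r(w)`, the number of positions `j` with `w_i - r < a_j < w_i`; the first inequality
is written without subtraction. -/
def B (r : ℕ) (w : List ℕ) (i : ℕ) : ℕ :=
  #{j ∈ Icc 1 w.length |
    letter w i < letter (rearr w) j + r ∧ letter (rearr w) j < letter w i}

/-- The `r`-gap Denert statistic. -/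
def rden (r : ℕ) (w : List ℕ) : ℕ :=
  (∑ i ∈ rExc r w, (i + B r w i)) + imv (rEXCL r w) + inv (rNEXCL r w)

end RWord

/-! Words are built by inserting the letters in increasing order, all copies of a letter x at once,
and both generating functions are followed as polynomials in t. Write e_k(n) and h_k(n) for the
elementary and complete symmetric functions of q, ..., q^n, let p be the number of letters y with y
+ r ≤ x, and b the number with x - r < y < x. A copy of the largest letter is a weak right-to-left
minimum exactly when it lies in the final run of such copies. So if ρ copies of x belong to R, then
ρ copies go to the end and the other c are inserted before smaller letters.

For `rmaj`, a word with d r-descents has b + d closed spaces, where x creates no new r-descent, and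
p - d open ones. The c copies contribute the sum over k + l = c of t^k q^(k(k-1)/2 + k(b+d))
e_k(p-d) h_l(b+d+k) (`sum_majWt_insertions`). Insertion is thus a linear operator on polynomials of
degree at most p in t. It is diagonal on P_{p,j} = t^j (1-t)(1-tq)⋯(1-tq^(p-j-1)), with eigenvalue
h_c(j+b) (`insertionOp_eigenPoly`).

For `rden`, position i is an r-excedance exactly when at least i letters y satisfy y + r ≤ w_i
(`mem_rExc_iff`). A partial word is recorded as a state: which of the first p positions will be
excedances, the word E of their letters, in which e placeholders Ω stand for larger letters, and the
word N of the other letters. Increasing p by one adds either a non-excedance or a placeholder of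
weight t q^(p+1) (`stateSum_open_succ`). Inserting x turns k placeholders into x, puts l copies into
N behind the part already fixed by the pattern, and ρ copies at the end of N (`stateSum_letter`).
The condition on R concerns N alone, because excedance letters are irrelevant to the weak
right-to-left minima (`rlMinL_rNEXCL`).

The link is the invariant `Matches`: the `rmaj` polynomial is Σ_j c_j P_{p,j} and, with the same
c_j, the sum over states with e placeholders is Σ_j c_j e_e(j) P_{p,j} for every e. Opening a
position preserves it, by P_{p,j} = P_{p+1,j} + q^(p-j) P_{p+1,j+1} and the Pascal rule for e_e(j).
Inserting x multiplies c_j by h_c(j+b) on both sides: on one side this is the eigenvalue, on the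
other the q-Vandermonde identity `sum_replQ_mul_completeQ_mul_elemQ`. Once all letters are inserted
and all positions opened, e = 0 and e_0(j) = 1, so the two polynomials agree. -/

namespace RWord

/-! ### Symmetric functions of powers of q and the insertion generating function. -/

section Algebra

variable {A : Type*} [CommRing A]

/-- The complete homogeneous symmetric function of degree `c` in `q, q ^ 2, …, q ^ y`. -/
def completeQ (q : A) : ℕ → ℕ → A
  | _, 0 => 1
  | 0, _ + 1 => 0
  | y + 1, c + 1 => completeQ q y (c + 1) + q ^ (y + 1) * completeQ q (y + 1) c

/-- The elementary symmetric function of degree `k` in `q, q ^ 2, …, q ^ n`. -/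
def elemQ (q : A) : ℕ → ℕ → A
  | _, 0 => 1
  | 0, _ + 1 => 0
  | n + 1, k + 1 => elemQ q n (k + 1) + q ^ (n + 1) * elemQ q n k

/-- The `q`-binomial coefficient `[e + k, k]` multiplied by `q ^ (k choose 2)`. -/
def replQ (q : A) : ℕ → ℕ → A
  | _, 0 => 1
  | 0, k + 1 => q ^ k * replQ q 0 k
  | e + 1, k + 1 => q ^ (k + 1) * replQ q e (k + 1) + q ^ k * replQ q (e + 1) k

@[simp] lemma completeQ_zero_right (q : A) (y : ℕ) : completeQ q y 0 = 1 := by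
  cases y <;> simp [completeQ]

@[simp] lemma completeQ_zero_succ (q : A) (c : ℕ) : completeQ q 0 (c + 1) = 0 := by
  simp [completeQ]

lemma completeQ_succ (q : A) (y c : ℕ) :
    completeQ q (y + 1) (c + 1) = completeQ q y (c + 1) + q ^ (y + 1) * completeQ q (y + 1) c := by
  rw [completeQ]

@[simp] lemma elemQ_zero_right (q : A) (n : ℕ) : elemQ q n 0 = 1 := by
  cases n <;> simp [elemQ]

@[simp] lemma elemQ_zero_succ (q : A) (k : ℕ) : elemQ q 0 (k + 1) = 0 := by
  simp [elemQ]

lemma elemQ_succ (q : A) (n k : ℕ) :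
    elemQ q (n + 1) (k + 1) = elemQ q n (k + 1) + q ^ (n + 1) * elemQ q n k := by
  rw [elemQ]

/-- The other Pascal rule, which splits off the factor `q` instead of `q ^ (n + 1)`. -/
lemma elemQ_succ' (q : A) (n k : ℕ) :
    elemQ q (n + 1) (k + 1) = q ^ (k + 1) * (elemQ q n (k + 1) + elemQ q n k) := by
  induction n generalizing k with
  | zero => cases k <;> simp [elemQ]
  | succ n ih =>
    cases k with
    | zero =>
      have h1 := ih 0
      have h2 := elemQ_succ q n 0
      have h3 := elemQ_succ q (n + 1) 0
      simp only [elemQ_zero_right] at h1 h2 h3 ⊢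
      linear_combination h3 + h1 - q * h2
    | succ k =>
      linear_combination elemQ_succ q (n + 1) (k + 1) + ih (k + 1) + q ^ (n + 2) * ih k -
        q ^ (k + 2) * (elemQ_succ q n (k + 1) + elemQ_succ q n k)

@[simp] lemma replQ_zero_right (q : A) (e : ℕ) : replQ q e 0 = 1 := by
  cases e <;> simp [replQ]

lemma replQ_zero_succ (q : A) (k : ℕ) : replQ q 0 (k + 1) = q ^ k * replQ q 0 k := by
  rw [replQ]

lemma replQ_succ (q : A) (e k : ℕ) :
    replQ q (e + 1) (k + 1) = q ^ (k + 1) * replQ q e (k + 1) + q ^ k * replQ q (e + 1) k := by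
  rw [replQ]

/-- A `q`-Vandermonde convolution. -/
lemma sum_replQ_mul_completeQ_mul_elemQ (q : A) (j e b c : ℕ) :
    ∑ x ∈ antidiagonal c,
      q ^ (x.1 * b) * replQ q e x.1 * completeQ q (b + e + x.1) x.2 * elemQ q j (e + x.1) =
      elemQ q j e * completeQ q (j + b) c := by
  induction j generalizing e b c with
  | zero =>
    cases c with
    | zero => simp
    | succ c =>
      rw [Finset.Nat.sum_antidiagonal_succ, Finset.sum_eq_zero]
      · cases e <;> simp
      · intro x _
        rw [show e + (x.1 + 1) = (e + x.1) + 1 by ring, elemQ_zero_succ, mul_zero]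
  | succ j ih =>
    -- This is the induction hypothesis at b + 1, times q ^ b. It absorbs the part of the sum in
    -- which x.1 is shifted by one.
    have second (e c : ℕ) : ∑ x ∈ antidiagonal c, q ^ ((x.1 + 1) * b) * (q ^ x.1 * replQ q e x.1) *
        completeQ q (b + e + (x.1 + 1)) x.2 * elemQ q j (e + x.1) =
        q ^ b * (elemQ q j e * completeQ q (j + (b + 1)) c) := by
      rw [← ih, Finset.mul_sum]
      refine Finset.sum_congr rfl fun x _ => ?_
      rw [show b + e + (x.1 + 1) = b + 1 + e + x.1 by ring]
      ring
    cases e with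
    | zero =>
      cases c with
      | zero => simp
      | succ c =>
        have h0 := ih 0 b (c + 1)
        rw [Finset.Nat.sum_antidiagonal_succ] at h0 ⊢
        have h2 := second 0 c
        have key : ∑ x ∈ antidiagonal c, q ^ ((x.1 + 1) * b) * replQ q 0 (x.1 + 1) *
            completeQ q (b + 0 + (x.1 + 1)) x.2 * elemQ q (j + 1) (0 + (x.1 + 1)) =
            ∑ x ∈ antidiagonal c, q ^ ((x.1 + 1) * b) * replQ q 0 (x.1 + 1) *
            completeQ q (b + 0 + (x.1 + 1)) x.2 * elemQ q j (0 + (x.1 + 1)) +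
            q ^ (j + 1) * ∑ x ∈ antidiagonal c,
              q ^ ((x.1 + 1) * b) * (q ^ x.1 * replQ q 0 x.1) *
              completeQ q (b + 0 + (x.1 + 1)) x.2 * elemQ q j (0 + x.1) := by
          rw [Finset.mul_sum, ← Finset.sum_add_distrib]
          refine Finset.sum_congr rfl fun x _ => ?_
          rw [replQ_zero_succ, zero_add, zero_add, elemQ_succ]
          ring
        simp only [] at h0 ⊢
        rw [key, h2]
        simp only [add_zero, elemQ_zero_right, mul_one, one_mul] at h0 ⊢
        rw [← add_assoc (G := A), h0, show j + 1 + b = (j + b) + 1 by ring, completeQ_succ,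
          show j + (b + 1) = j + b + 1 by ring]
        ring
    | succ e =>
      have h0 := ih (e + 1) b c
      have h1 := ih e (b + 1) c
      -- The two terms of the recursion of `replQ` lead to the hypothesis at (e, b + 1, c) and at (e
      -- + 1, b + 1, c - 1); the latter is absent when c = 0.
      have key : ∑ x ∈ antidiagonal c, q ^ (x.1 * b) * replQ q (e + 1) x.1 *
            completeQ q (b + (e + 1) + x.1) x.2 * elemQ q j (e + x.1) =
          elemQ q j e * completeQ q (j + (b + 1)) c +
            if c = 0 then 0 else
              q ^ b * (elemQ q j (e + 1) * completeQ q (j + (b + 1)) (c - 1)) := by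
        cases c with
        | zero => simp
        | succ c =>
          rw [← h1, Finset.Nat.sum_antidiagonal_succ, Finset.Nat.sum_antidiagonal_succ,
            if_neg (by omega), Nat.add_sub_cancel, ← second, add_assoc (G := A), ← Finset.sum_add_distrib]
          congr 1
          · simp only [replQ_zero_right, add_zero]
            rw [show b + (e + 1) = b + 1 + e by ring]
            ring
          · refine Finset.sum_congr rfl fun x _ => ?_
            simp only []
            rw [replQ_succ, show b + (e + 1) + (x.1 + 1) = b + 1 + e + (x.1 + 1) by ring,
              show e + 1 + x.1 = e + (x.1 + 1) by ring]
            ring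
      have split : ∑ x ∈ antidiagonal c, q ^ (x.1 * b) * replQ q (e + 1) x.1 *
            completeQ q (b + (e + 1) + x.1) x.2 * elemQ q (j + 1) (e + 1 + x.1) =
          ∑ x ∈ antidiagonal c, q ^ (x.1 * b) * replQ q (e + 1) x.1 *
            completeQ q (b + (e + 1) + x.1) x.2 * elemQ q j (e + 1 + x.1) +
          q ^ (j + 1) * ∑ x ∈ antidiagonal c, q ^ (x.1 * b) * replQ q (e + 1) x.1 *
            completeQ q (b + (e + 1) + x.1) x.2 * elemQ q j (e + x.1) := by
        rw [Finset.mul_sum, ← Finset.sum_add_distrib]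
        refine Finset.sum_congr rfl fun x _ => ?_
        rw [show e + 1 + x.1 = (e + x.1) + 1 by ring, elemQ_succ]
        ring
      rw [split, h0, key, elemQ_succ, show j + (b + 1) = j + b + 1 by ring,
        show j + 1 + b = j + b + 1 by ring]
      cases c with
      | zero => simp
      | succ c =>
        rw [if_neg (by omega), Nat.add_sub_cancel, completeQ_succ]
        ring

/-- The generating function of the ways of inserting `c` copies of a maximal letter into a word
with `H` closed spaces and `s` open spaces. -/
def insertionGF (q t : A) (H s c : ℕ) : A :=
  ∑ x ∈ antidiagonal c,
    t ^ x.1 * q ^ (x.1.choose 2 + x.1 * H) * elemQ q s x.1 * completeQ q (H + x.1) x.2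

@[simp] lemma insertionGF_zero_right (q t : A) (H s : ℕ) : insertionGF q t H s 0 = 1 := by
  simp [insertionGF]

lemma insertionGF_zero_mid (q t : A) (H c : ℕ) : insertionGF q t H 0 c = completeQ q H c := by
  unfold insertionGF
  cases c with
  | zero => simp
  | succ c =>
    rw [Finset.Nat.sum_antidiagonal_succ, Finset.sum_eq_zero]
    · simp
    · intro x _
      simp

lemma choose_two_succ (i : ℕ) : (i + 1).choose 2 = i.choose 2 + i := by
  rw [Nat.choose_succ_succ' i 1, Nat.choose_one_right, add_comm]

/-- Case distinction at a closed first space: it stays empty, or a copy is placed there. In both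
cases the remaining insertions happen one position further right, so each new descent costs one more
q, whence t * q. -/
lemma insertionGF_closed_succ (q t : A) (H s c : ℕ) :
    insertionGF q t (H + 1) s (c + 1) =
      insertionGF q (t * q) H s (c + 1) + q ^ (H + 1) * insertionGF q (t * q) (H + 1) s c := by
  unfold insertionGF
  rw [Finset.Nat.sum_antidiagonal_succ', Finset.Nat.sum_antidiagonal_succ', Finset.mul_sum,
    add_assoc (G := A), ← Finset.sum_add_distrib]
  congr 1
  · simp only [completeQ_zero_right]
    ring
  · refine Finset.sum_congr rfl fun x _ => ?_
    simp only []
    rw [show H + 1 + x.1 = (H + x.1) + 1 by ring, completeQ_succ]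
    ring

/-- The same case distinction at an open first space. A copy placed there creates a descent at
position 1, and the first space counts as closed afterwards. -/
lemma insertionGF_open_succ (q t : A) (H s c : ℕ) :
    insertionGF q t H (s + 1) (c + 1) =
      insertionGF q (t * q) H s (c + 1) + t * q ^ (H + 1) * insertionGF q (t * q) (H + 1) s c := by
  unfold insertionGF
  rw [Finset.Nat.sum_antidiagonal_succ, Finset.Nat.sum_antidiagonal_succ, Finset.mul_sum,
    add_assoc (G := A), ← Finset.sum_add_distrib]
  congr 1
  · simp
  · refine Finset.sum_congr rfl fun x _ => ?_
    simp only []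
    rw [show H + 1 + x.1 = H + (x.1 + 1) by ring, elemQ_succ', choose_two_succ]
    ring

/-- Here the last variable of `elemQ` is split off instead, so t is not rescaled; this is what makes
an induction on p possible for `insertionOp`. -/
lemma insertionGF_open_succ' (q t : A) (H s c : ℕ) :
    insertionGF q t H (s + 1) (c + 1) =
      insertionGF q t H s (c + 1) + t * q ^ (H + s + 1) * insertionGF q t (H + 1) s c := by
  unfold insertionGF
  rw [Finset.Nat.sum_antidiagonal_succ, Finset.Nat.sum_antidiagonal_succ, Finset.mul_sum,
    add_assoc (G := A), ← Finset.sum_add_distrib]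
  congr 1
  · simp
  · refine Finset.sum_congr rfl fun x _ => ?_
    simp only []
    rw [show H + 1 + x.1 = H + (x.1 + 1) by ring, elemQ_succ, choose_two_succ]
    ring

end Algebra

/-! ### Diagonalisation of the insertion operator. -/

section Eigenbasis

open Polynomial

variable {A : Type*} [CommRing A]

/-- The polynomials `t ^ j * (1 - t) * (1 - t q) * ⋯ * (1 - t q ^ (p - j - 1))`. -/
noncomputable def eigenPoly (q : A) (p j : ℕ) : A[X] := X ^ j * ∏ i ∈ range (p - j), (1 - X * C q ^ i)

lemma eigenPoly_self (q : A) (p : ℕ) : eigenPoly q p p = X ^ p := by simp [eigenPoly]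

lemma X_mul_eigenPoly (q : A) (p j : ℕ) : X * eigenPoly q p j = eigenPoly q (p + 1) (j + 1) := by
  simp only [eigenPoly, Nat.add_sub_add_right]; ring

/-- Write 1 = (1 - X q^(p-j)) + X q^(p-j) for the next factor of the product. -/
lemma eigenPoly_eq_add (q : A) {p j : ℕ} (h : j ≤ p) :
    eigenPoly q p j = eigenPoly q (p + 1) j + C q ^ (p - j) * eigenPoly q (p + 1) (j + 1) := by
  rw [← X_mul_eigenPoly]
  simp only [eigenPoly]
  rw [show p + 1 - j = p - j + 1 by omega, Finset.prod_range_succ]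
  ring

lemma eigenPoly_mem_degreeLT (q : A) {p j : ℕ} (h : j ≤ p) :
    eigenPoly q p j ∈ degreeLT A (p + 1) := by
  rw [mem_degreeLT]
  refine lt_of_le_of_lt (degree_le_of_natDegree_le (n := p) ?_) (by exact_mod_cast Nat.lt_succ_self p)
  refine natDegree_mul_le.trans ?_
  have h2 : (∏ i ∈ range (p - j), (1 - X * C q ^ i) : A[X]).natDegree ≤ p - j := by
    refine (natDegree_prod_le _ _).trans ?_
    calc _ ≤ ∑ i ∈ range (p - j), 1 := by
          refine Finset.sum_le_sum fun i _ => ?_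
          rw [← C_pow]
          compute_degree
      _ = p - j := by simp
  have := natDegree_X_pow_le (R := A) j
  omega

/-- The linear operator by which the insertion of `c` copies of a maximal letter acts on
generating polynomials. -/
noncomputable def insertionOp (q : A) (p b c : ℕ) : A[X] →ₗ[A] A[X] :=
  (basisMonomials A).constr A fun d => X ^ d * insertionGF (C q) X (b + d) (p - d) c

lemma insertionOp_X_pow (q : A) (p b c d : ℕ) :
    insertionOp q p b c (X ^ d) = X ^ d * insertionGF (C q) X (b + d) (p - d) c := by
  have h := (basisMonomials A).constr_basis A
    (fun d => (X ^ d * insertionGF (C q) X (b + d) (p - d) c : A[X])) d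
  simp only [coe_basisMonomials] at h
  rwa [← X_pow_eq_monomial] at h

lemma insertionOp_zero (q : A) (p b : ℕ) (f : A[X]) : insertionOp q p b 0 f = f := by
  suffices insertionOp q p b 0 = LinearMap.id by rw [this]; rfl
  refine (basisMonomials A).ext fun d => ?_
  simp only [coe_basisMonomials]
  rw [← X_pow_eq_monomial, insertionOp_X_pow]
  simp

/-- On X ^ d with d ≤ p the subtraction p + 1 - d is not truncated, and the exponent of q in
`insertionGF_open_succ'` becomes p + 1 + b, the same for all d. Hence the recursion passes to linear
combinations. -/
lemma insertionOp_succ (q : A) (p b c : ℕ) {f : A[X]} (hf : f ∈ degreeLT A (p + 1)) :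
    insertionOp q (p + 1) b (c + 1) f =
      insertionOp q p b (c + 1) f + X * C q ^ (p + 1 + b) * insertionOp q p (b + 1) c f := by
  rw [mem_degreeLT] at hf
  rw [f.as_sum_range' (p + 1) ?_]
  · simp only [map_sum, Finset.mul_sum, ← Finset.sum_add_distrib]
    refine Finset.sum_congr rfl fun d hd => ?_
    rw [Finset.mem_range] at hd
    rw [← C_mul_X_pow_eq_monomial, ← smul_eq_C_mul]
    simp only [map_smul, insertionOp_X_pow]
    rw [show p + 1 - d = p - d + 1 by omega, insertionGF_open_succ',
      show b + d + (p - d) + 1 = p + 1 + b by omega, show b + 1 + d = b + d + 1 by ring]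
    simp only [smul_eq_C_mul]
    ring
  · by_cases h0 : f = 0
    · simp [h0]
    · exact (natDegree_lt_iff_degree_lt h0).2 hf

lemma C_pow_mul_eq_smul (q : A) (n : ℕ) (f : A[X]) : C q ^ n * f = (q ^ n) • f := by
  rw [smul_eq_C_mul, C_pow]

lemma completeQ_C (q : A) (y c : ℕ) : completeQ (C q) y c = C (completeQ q y c) := by
  induction y generalizing c with
  | zero => cases c <;> simp
  | succ y ih =>
    induction c with
    | zero => simp
    | succ c ihc => rw [completeQ_succ, completeQ_succ, ih, ihc]; simp

/-- Induction on p, and for p + 1 descending induction on j. Since P_{p+1,j} = P_{p,j} - q^(p-j)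
P_{p+1,j+1}, the operator for p + 1 is known on both terms, by `insertionOp_succ` and by the case j
+ 1, and the recursion of `completeQ` makes the eigenvalues fit. -/
lemma insertionOp_eigenPoly (q : A) (p j b c : ℕ) (hj : j ≤ p) :
    insertionOp q p b c (eigenPoly q p j) = completeQ q (j + b) c • eigenPoly q p j := by
  induction p generalizing j b c with
  | zero =>
    obtain rfl : j = 0 := by omega
    rw [eigenPoly_self, insertionOp_X_pow, insertionGF_zero_mid]
    simp [completeQ_C, smul_eq_C_mul]
  | succ p ih =>
    cases c with
    | zero => simp [insertionOp_zero]
    | succ c =>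
      induction hj using Nat.decreasingInduction with
      | self =>
        rw [eigenPoly_self, insertionOp_X_pow, Nat.sub_self, insertionGF_zero_mid]
        rw [completeQ_C, smul_eq_C_mul, mul_comm, add_comm b]
      | of_succ j hj ihj =>
        have hjp : j ≤ p := by omega
        have e1 : eigenPoly q (p + 1) j =
            eigenPoly q p j - C q ^ (p - j) * eigenPoly q (p + 1) (j + 1) := by
          rw [eigenPoly_eq_add q hjp]; ring
        have e2 : insertionOp q (p + 1) b (c + 1) (eigenPoly q (p + 1) j) =
            insertionOp q (p + 1) b (c + 1) (eigenPoly q p j) -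
              (q ^ (p - j)) • insertionOp q (p + 1) b (c + 1) (eigenPoly q (p + 1) (j + 1)) := by
          rw [e1, C_pow_mul_eq_smul, map_sub, map_smul]
        rw [e2, ihj, insertionOp_succ q p b c (eigenPoly_mem_degreeLT q hjp), ih j b _ hjp,
          ih j (b + 1) c hjp]
        rw [mul_smul_comm, mul_right_comm, X_mul_eigenPoly, eigenPoly_eq_add q hjp]
        rw [show j + 1 + b = j + b + 1 by ring, show j + (b + 1) = j + b + 1 by ring,
          completeQ_succ, show p + 1 + b = (p - j) + (j + b + 1) by omega]
        simp only [smul_eq_C_mul, C_add, C_mul, C_pow, pow_add]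
        ring

end Eigenbasis

/-! ### Recursive descent statistics and the insertion of a maximal letter. -/

/-- Whether prepending `x` to the word creates an `r`-descent. -/
def headDesc (r x : ℕ) : List ℕ → ℕ
  | [] => 0
  | y :: _ => if y + r ≤ x then 1 else 0

/-- The number of `r`-descents, by recursion on the word. -/
def desL (r : ℕ) : List ℕ → ℕ
  | [] => 0
  | x :: w => headDesc r x w + desL r w

/-- The `r`-major index, by recursion on the word. -/
def majL (r : ℕ) : List ℕ → ℕ
  | [] => 0
  | x :: w => majL r w + (headDesc r x w + desL r w) + w.countP (fun z => z < x ∧ x < z + r)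

/-- The words obtained from `v` by inserting, after its first `o` letters, `c` copies of `m`
none of which is at the end, and then appending `ρ` copies of `m`. -/
def insertions (m ρ : ℕ) : ℕ → List ℕ → ℕ → Finset (List ℕ)
  | _, [], 0 => {List.replicate ρ m}
  | _, [], _ + 1 => ∅
  | 0, x :: v, 0 => (insertions m ρ 0 v 0).image (List.cons x)
  | 0, x :: v, c + 1 =>
    (insertions m ρ 0 v (c + 1)).image (List.cons x) ∪
      (insertions m ρ 0 (x :: v) c).image (List.cons m)
  | o + 1, x :: v, c => (insertions m ρ o v c).image (List.cons x)
termination_by _ v c => (v.length, c)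

section Sums

variable {A : Type*} [AddCommMonoid A]

lemma sum_image_cons (x : ℕ) (s : Finset (List ℕ)) (f : List ℕ → A) :
    ∑ w ∈ s.image (List.cons x), f w = ∑ w ∈ s, f (x :: w) :=
  Finset.sum_image (List.cons_injective.injOn)

lemma sum_union_cons {x m : ℕ} (h : x ≠ m) (s s' : Finset (List ℕ)) (f : List ℕ → A) :
    ∑ w ∈ s.image (List.cons x) ∪ s'.image (List.cons m), f w =
      ∑ w ∈ s, f (x :: w) + ∑ w ∈ s', f (m :: w) := by
  rw [Finset.sum_union, sum_image_cons, sum_image_cons]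
  rw [Finset.disjoint_left]
  simp only [Finset.mem_image, not_exists, not_and]
  rintro _ ⟨a, -, rfl⟩ b - h'
  exact h (List.cons.inj h').1.symm

end Sums

lemma countP_eq_of_mem_insertions {m ρ c : ℕ} {v w : List ℕ} {o : ℕ}
    (hw : w ∈ insertions m ρ o v c) (p : ℕ → Prop) [DecidablePred p] (hp : ¬ p m) :
    w.countP p = v.countP p := by
  induction o, v, c using insertions.induct generalizing w with
  | case1 o =>
    rw [insertions, Finset.mem_singleton] at hw
    simp [hw, List.countP_replicate, hp]
  | case2 => simp [insertions] at hw
  | case3 x v ih =>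
    rw [insertions, Finset.mem_image] at hw
    obtain ⟨u, hu, rfl⟩ := hw
    simp [List.countP_cons, ih hu]
  | case4 x v c ih1 ih2 =>
    rw [insertions, Finset.mem_union, Finset.mem_image, Finset.mem_image] at hw
    obtain ⟨u, hu, rfl⟩ | ⟨u, hu, rfl⟩ := hw
    · simp [List.countP_cons, ih1 hu]
    · rw [List.countP_cons, ih2 hu]; simp [hp]
  | case5 o x v c ih =>
    rw [insertions, Finset.mem_image] at hw
    obtain ⟨u, hu, rfl⟩ := hw
    simp [List.countP_cons, ih hu]

/-- If nonempty, an insertion starts with the first letter of v or with m, and z < m + r excludes an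
r-descent from z to m. So inserting can only destroy a descent at the head. -/
lemma headDesc_le_of_mem_insertions {r m ρ c z : ℕ} {v w : List ℕ} (hz : z < m + r)
    (hw : w ∈ insertions m ρ 0 v c) : headDesc r z w ≤ headDesc r z v := by
  have hm (u : List ℕ) : headDesc r z (m :: u) = 0 := by simp [headDesc, hz]
  cases v with
  | nil =>
    cases c with
    | zero =>
      rw [insertions, Finset.mem_singleton] at hw
      cases ρ with
      | zero => simp [hw]
      | succ ρ => rw [hw, List.replicate_succ, hm]; simp
    | succ c => simp [insertions] at hw
  | cons x v =>
    cases c with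
    | zero =>
      rw [insertions, Finset.mem_image] at hw
      obtain ⟨u, hu, rfl⟩ := hw
      simp [headDesc]
    | succ c =>
      rw [insertions, Finset.mem_union, Finset.mem_image, Finset.mem_image] at hw
      obtain ⟨u, hu, rfl⟩ | ⟨u, hu, rfl⟩ := hw
      · simp [headDesc]
      · rw [hm]; simp

/-! ### The r-major index under insertion. -/

section Maj

variable {A : Type*} [CommRing A]

/-- The monomial recording the number of `r`-descents and the `r`-major index. -/
def majWt (r : ℕ) (q t : A) (w : List ℕ) : A := t ^ desL r w * q ^ majL r w

lemma majWt_cons (r : ℕ) (q t : A) (x : ℕ) (w : List ℕ) :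
    majWt r q t (x :: w) = q ^ w.countP (fun z => z < x ∧ x < z + r) *
      (t * q) ^ headDesc r x w * majWt r q (t * q) w := by
  simp only [majWt, desL, majL]
  ring

lemma sum_majWt_cons_of_headDesc_eq_zero {r m ρ c z : ℕ} (q t : A) {v : List ℕ} (hz : z ≤ m)
    (hr : 1 ≤ r) (h : headDesc r z v = 0) :
    ∑ w ∈ insertions m ρ 0 v c, majWt r q t (z :: w) =
      q ^ v.countP (fun y => y < z ∧ z < y + r) *
        ∑ w ∈ insertions m ρ 0 v c, majWt r q (t * q) w := by
  rw [Finset.mul_sum]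
  refine Finset.sum_congr rfl fun w hw => ?_
  have := headDesc_le_of_mem_insertions (r := r) (z := z) (by omega) hw
  rw [majWt_cons, show headDesc r z w = 0 by omega,
    countP_eq_of_mem_insertions hw _ (by omega)]
  ring

/-- Only the words that still start with y keep the descent from z, giving the factor t * q. The
words starting with m are counted as all words minus those starting with y. -/
lemma sum_majWt_cons_of_descent {r m ρ c z y : ℕ} (q t : A) {v : List ℕ} (hz : z ≤ m)
    (hr : 1 ≤ r) (hy : y < m) (h : y + r ≤ z) :
    ∑ w ∈ insertions m ρ 0 (y :: v) c, majWt r q t (z :: w) =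
      q ^ (y :: v).countP (fun y => y < z ∧ z < y + r) *
        (t * q * (∑ w ∈ insertions m ρ 0 v c, majWt r q (t * q) (y :: w)) +
        ∑ w ∈ insertions m ρ 0 (y :: v) c, majWt r q (t * q) w -
        ∑ w ∈ insertions m ρ 0 v c, majWt r q (t * q) (y :: w)) := by
  have hc (w) (hw : w ∈ insertions m ρ 0 (y :: v) c) :=
    countP_eq_of_mem_insertions hw (fun y => y < z ∧ z < y + r) (by omega)
  have h1 (w : List ℕ) : headDesc r z (y :: w) = 1 := by simp [headDesc, h]
  have h2 (w : List ℕ) : headDesc r z (m :: w) = 0 := by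
    simp only [headDesc]; rw [if_neg (by omega)]
  cases c with
  | zero =>
    simp only [insertions, sum_image_cons, Finset.mul_sum, add_sub_cancel_right]
    refine Finset.sum_congr rfl fun w hw => ?_
    rw [majWt_cons, h1, hc _ (by rw [insertions]; exact Finset.mem_image_of_mem _ hw)]
    ring
  | succ c =>
    have hyw (w) (hw : w ∈ insertions m ρ 0 v (c + 1)) := hc (y :: w) (by
      rw [insertions]; exact Finset.mem_union_left _ (Finset.mem_image_of_mem _ hw))
    have hmw (w) (hw : w ∈ insertions m ρ 0 (y :: v) c) := hc (m :: w) (by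
      rw [insertions]; exact Finset.mem_union_right _ (Finset.mem_image_of_mem _ hw))
    rw [insertions, sum_union_cons hy.ne, sum_union_cons hy.ne, ← add_assoc, add_sub_right_comm,
      add_sub_cancel_right, mul_add]
    congr 1
    · rw [Finset.mul_sum, Finset.mul_sum]
      refine Finset.sum_congr rfl fun w hw => ?_
      rw [majWt_cons, h1, hyw w hw]
      ring
    · rw [Finset.mul_sum]
      refine Finset.sum_congr rfl fun w hw => ?_
      rw [majWt_cons, h2, hmw w hw]
      ring

/-- The number of letters `y` of `v` with `m < y + r`, plus the number of `r`-descents: the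
number of spaces of `v` (before its letters) where a letter `m` creates no new `r`-descent. -/
def closedSpaces (r m : ℕ) (v : List ℕ) : ℕ := v.countP (fun y => m < y + r) + desL r v

/-- A letter y with m < y + r cannot be the bottom of a descent between letters below m, so the two
kinds of closed spaces are disjoint. This keeps the number of open spaces from being truncated. -/
lemma countP_add_desL_le (r m : ℕ) (y : ℕ) (v : List ℕ) (hy : y < m) (hv : ∀ x ∈ v, x < m) :
    v.countP (fun y => m < y + r) + desL r (y :: v) ≤ v.length := by
  induction v generalizing y with
  | nil => simp [desL, headDesc]
  | cons x v ih =>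
    have := ih x (hv x (by simp)) fun z hz => hv z (by simp [hz])
    have hx := hv x (by simp)
    simp only [desL, List.countP_cons, List.length_cons, headDesc, decide_eq_true_eq] at this ⊢
    split_ifs <;> omega

/-- The effect of prepending a letter that forms a descent with the first letter: an open first
space turns into a closed one. -/
lemma mul_insertionGF_open_eq (q u : A) (H s c : ℕ) :
    u * insertionGF q (u * q) H s c + insertionGF q u H (s + 1) c - insertionGF q (u * q) H s c =
      u * insertionGF q u (H + 1) s c := by
  cases c with
  | zero => simp
  | succ c => rw [insertionGF_open_succ, insertionGF_closed_succ]; ring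

/-- Both claims are proved together by induction on v. The second forbids copies before the first
letter; it is needed because a descent at the head treats the words starting with y and those
starting with m differently. The first then follows by induction on c, a copy placed in front of the
word being handled like any other prepended letter. -/
lemma sum_majWt_insertions_aux (r m ρ : ℕ) (hr : 1 ≤ r) (q : A) (v : List ℕ)
    (hv : ∀ x ∈ v, x < m) :
    (∀ c t, ∑ w ∈ insertions m ρ 0 v c, majWt r q t w =
      majWt r q t v * insertionGF q t (closedSpaces r m v) (v.length - closedSpaces r m v) c) ∧
    ∀ y v', v = y :: v' → ∀ c t, ∑ w ∈ insertions m ρ 0 v' c, majWt r q t (y :: w) =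
      majWt r q t v * insertionGF q (t * q) (v'.countP (fun y => m < y + r) + desL r v)
        (v'.length - (v'.countP (fun y => m < y + r) + desL r v)) c := by
  induction v with
  | nil =>
    refine ⟨fun c t => ?_, by simp⟩
    have h1 : ∀ n, desL r (List.replicate n m) = 0 := by
      intro n
      induction n with
      | zero => rfl
      | succ n ih =>
        cases n with
        | zero => simp [desL, headDesc]
        | succ n =>
          rw [List.replicate_succ, desL, ih, List.replicate_succ]
          simp [headDesc]; omega
    have h2 : ∀ n, majL r (List.replicate n m) = 0 := by
      intro n
      induction n with
      | zero => rfl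
      | succ n ih =>
        have := h1 (n + 1)
        rw [List.replicate_succ, desL] at this
        rw [List.replicate_succ, majL, ih, this]
        simp [List.countP_replicate]
    cases c with
    | zero => simp [insertions, majWt, h1, h2, desL, majL]
    | succ c => simp [insertions, closedSpaces, desL, insertionGF_zero_mid]
  | cons x v ih =>
    have hx : x < m := hv x (by simp)
    have hv' : ∀ y ∈ v, y < m := fun y hy => hv y (by simp [hy])
    obtain ⟨ih1, ih2⟩ := ih hv'
    have hA : ∀ c t, ∑ w ∈ insertions m ρ 0 v c, majWt r q t (x :: w) =
      majWt r q t (x :: v) * insertionGF q (t * q) (v.countP (fun y => m < y + r) + desL r (x :: v))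
        (v.length - (v.countP (fun y => m < y + r) + desL r (x :: v))) c := by
      intro c t
      by_cases h0 : headDesc r x v = 0
      · rw [sum_majWt_cons_of_headDesc_eq_zero q t hx.le hr h0, ih1, majWt_cons, desL, h0,
          closedSpaces, zero_add]
        ring
      · cases v with
        | nil => simp [headDesc] at h0
        | cons y v =>
          have hyx : y + r ≤ x := by
            by_contra hcon
            exact h0 (by simp only [headDesc]; rw [if_neg hcon])
          have hy : y < m := hv' y (by simp)
          have hle := countP_add_desL_le r m y v hy fun z hz => hv' z (by simp [hz])
          have h1 : headDesc r x (y :: v) = 1 := by simp [headDesc, hyx]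
          rw [sum_majWt_cons_of_descent q t hx.le hr hy hyx, ih1, ih2 y v rfl,
            majWt_cons r q t x, h1]
          -- As y + r ≤ x < m, the letter y is not among those within distance r of m.
          have hN : (y :: v).countP (fun y => m < y + r) = v.countP (fun y => m < y + r) := by
            rw [List.countP_cons, if_neg (by simp; omega)]; rfl
          have hd : desL r (x :: y :: v) = desL r (y :: v) + 1 := by rw [desL, h1, add_comm]
          rw [closedSpaces, hN, hd]
          set H := v.countP (fun y => m < y + r) + desL r (y :: v) with hH
          rw [show (y :: v).length - H = v.length - H + 1 by simp; omega,
            show v.countP (fun y => m < y + r) + (desL r (y :: v) + 1) = H + 1 by omega,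
            show (y :: v).length - (H + 1) = v.length - H by simp]
          have := mul_insertionGF_open_eq q (t * q) H (v.length - H) c
          linear_combination q ^ (y :: v).countP (fun y => y < x ∧ x < y + r) *
            majWt r q (t * q) (y :: v) * this
    refine ⟨fun c => ?_, ?_⟩
    · have hle := countP_add_desL_le r m x v hx hv'
      induction c with
      | zero =>
        intro t
        rw [insertions, sum_image_cons, hA]
        simp
      | succ c ihc =>
        intro t
        rw [insertions, sum_union_cons hx.ne, hA]
        have hcount : (x :: v).countP (fun y => y < m ∧ m < y + r) =
            (x :: v).countP (fun y => m < y + r) :=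
          List.countP_congr fun y hy => by simpa using fun _ => hv y hy
        by_cases hE : x + r ≤ m
        · rw [sum_majWt_cons_of_descent q t le_rfl hr hx hE, ihc, hA, hcount]
          have hN : (x :: v).countP (fun y => m < y + r) = v.countP (fun y => m < y + r) := by
            rw [List.countP_cons, if_neg (by simp; omega)]; rfl
          rw [closedSpaces, hN]
          set H := v.countP (fun y => m < y + r) + desL r (x :: v) with hH
          rw [show (x :: v).length - H = v.length - H + 1 by simp; omega, insertionGF_open_succ]
          have := mul_insertionGF_open_eq q (t * q) H (v.length - H) c
          have hq : q ^ v.countP (fun y => m < y + r) * majWt r q (t * q) (x :: v) =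
              q ^ H * majWt r q t (x :: v) := by
            simp only [majWt, hH]; ring
          rw [pow_succ]
          linear_combination q ^ v.countP (fun y => m < y + r) *
            majWt r q (t * q) (x :: v) * this +
            (t * q) * insertionGF q (t * q) (H + 1) (v.length - H) c * hq
        · have h0 : headDesc r m (x :: v) = 0 := by simp only [headDesc]; rw [if_neg hE]
          rw [sum_majWt_cons_of_headDesc_eq_zero q t le_rfl hr h0, ihc, hcount]
          have hN : (x :: v).countP (fun y => m < y + r) = v.countP (fun y => m < y + r) + 1 := by
            rw [List.countP_cons, if_pos (by simp; omega)]
          rw [closedSpaces, hN]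
          set H := v.countP (fun y => m < y + r) + desL r (x :: v) with hH
          rw [show v.countP (fun y => m < y + r) + 1 + desL r (x :: v) = H + 1 by omega,
            show (x :: v).length - (H + 1) = v.length - H by simp, insertionGF_closed_succ]
          have hq : q ^ (v.countP (fun y => m < y + r) + 1) * majWt r q (t * q) (x :: v) =
              q ^ (H + 1) * majWt r q t (x :: v) := by
            simp only [majWt, hH]; ring
          linear_combination insertionGF q (t * q) (H + 1) (v.length - H) c * hq
    · rintro y v' h
      obtain ⟨rfl, rfl⟩ := List.cons.inj h
      exact hA

/-- The generating function of the `r`-descent number and the `r`-major index over the words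
obtained by inserting copies of a maximal letter. -/
lemma sum_majWt_insertions (r m ρ c : ℕ) (hr : 1 ≤ r) (q t : A) (v : List ℕ)
    (hv : ∀ x ∈ v, x < m) :
    ∑ w ∈ insertions m ρ 0 v c, majWt r q t w =
      majWt r q t v * insertionGF q t (closedSpaces r m v) (v.length - closedSpaces r m v) c :=
  (sum_majWt_insertions_aux r m ρ hr q v hv).1 c t

end Maj

/-! ### Weak right-to-left minima and the recognition of insertions. -/

/-- The multiset of weak right-to-left minima, by recursion on the word. -/
def rlMinL : List ℕ → Multiset ℕ
  | [] => 0
  | x :: w => if ∀ y ∈ w, x ≤ y then x ::ₘ rlMinL w else rlMinL w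

lemma rlMinL_le (w : List ℕ) : rlMinL w ≤ w := by
  induction w with
  | nil => simp [rlMinL]
  | cons x w ih =>
    rw [rlMinL, ← Multiset.cons_coe]
    split_ifs
    · exact Multiset.cons_le_cons x ih
    · exact ih.trans (Multiset.le_cons_self _ _)

lemma rlMinL_replicate (n m : ℕ) : rlMinL (List.replicate n m) = Multiset.replicate n m := by
  induction n with
  | zero => simp [rlMinL]
  | succ n ih =>
    rw [List.replicate_succ, rlMinL, if_pos, ih, Multiset.replicate_succ]
    intro y hy
    rw [List.eq_of_mem_replicate hy]

lemma length_of_mem_insertions {m ρ c : ℕ} {v w : List ℕ} {o : ℕ}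
    (hw : w ∈ insertions m ρ o v c) : w.length = v.length + c + ρ := by
  induction o, v, c using insertions.induct generalizing w with
  | case1 o => rw [insertions, Finset.mem_singleton] at hw; simp [hw]
  | case2 => simp [insertions] at hw
  | case3 x v ih =>
    rw [insertions, Finset.mem_image] at hw
    obtain ⟨u, hu, rfl⟩ := hw
    simp [ih hu]; ring
  | case4 x v c ih1 ih2 =>
    rw [insertions, Finset.mem_union, Finset.mem_image, Finset.mem_image] at hw
    obtain ⟨u, hu, rfl⟩ | ⟨u, hu, rfl⟩ := hw
    · simp [ih1 hu]; ring
    · simp [ih2 hu]; ring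
  | case5 o x v c ih =>
    rw [insertions, Finset.mem_image] at hw
    obtain ⟨u, hu, rfl⟩ := hw
    simp [ih hu]; ring

lemma nil_mem_insertions_iff {m ρ o c : ℕ} {v : List ℕ} :
    [] ∈ insertions m ρ o v c ↔ v = [] ∧ c = 0 ∧ ρ = 0 := by
  constructor
  · intro h
    have := length_of_mem_insertions h
    simp at this
    exact ⟨List.eq_nil_of_length_eq_zero (by omega), by omega, by omega⟩
  · rintro ⟨rfl, rfl, rfl⟩
    simp [insertions]

lemma cons_mem_insertions_iff {m ρ o c z x : ℕ} {v w : List ℕ} :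
    z :: w ∈ insertions m ρ o (x :: v) c ↔
      (z = x ∧ w ∈ insertions m ρ (o - 1) v c) ∨
        (z = m ∧ o = 0 ∧ ∃ c', c = c' + 1 ∧ w ∈ insertions m ρ 0 (x :: v) c') := by
  cases o with
  | zero =>
    cases c with
    | zero => rw [insertions]; simp [eq_comm, and_comm]
    | succ c => rw [insertions]; simp [eq_comm, and_comm]
  | succ o => rw [insertions]; simp [eq_comm, and_comm]

/-- An inserted copy of m precedes some smaller letter and is no weak right-to-left minimum, while
the ρ appended copies all are. So the minima determine how many copies end the word, and this gives
a description of the insertions without recursion. -/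
lemma mem_insertions {m ρ : ℕ} {o : ℕ} {v : List ℕ} {c : ℕ} {w : List ℕ}
    (hv : ∀ x ∈ v, x < m) (hw : ∀ x ∈ w, x ≤ m) (ho : o ≤ v.length) :
    w ∈ insertions m ρ o v c ↔ w.filter (· ≠ m) = v ∧ w.count m = c + ρ ∧ m ∉ w.take o ∧
      rlMinL w = rlMinL v + Multiset.replicate ρ m := by
  induction w generalizing o v c with
  | nil =>
    rw [nil_mem_insertions_iff]
    simp only [List.filter_nil, List.count_nil, List.take_nil, List.not_mem_nil, not_false_eq_true,
      true_and, rlMinL]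
    constructor
    · rintro ⟨rfl, rfl, rfl⟩; simp [rlMinL]
    · rintro ⟨rfl, h, -⟩; exact ⟨rfl, by omega, by omega⟩
  | cons z w ih =>
    have hz : z ≤ m := hw z (by simp)
    have hw' : ∀ x ∈ w, x ≤ m := fun x hx => hw x (by simp [hx])
    cases v with
    | nil =>
      obtain rfl : o = 0 := by simpa using ho
      have key : List.filter (· ≠ m) (z :: w) = [] ↔
          z :: w = List.replicate (z :: w).length m := by
        rw [List.eq_replicate_iff]; simp [List.filter_eq_nil_iff]
      have hmem : z :: w ∈ insertions m ρ 0 [] c ↔ c = 0 ∧ z :: w = List.replicate ρ m := by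
        cases c <;> simp [insertions]
      rw [hmem, key]
      constructor
      · rintro ⟨rfl, h⟩
        rw [h]
        simp [rlMinL, rlMinL_replicate]
      · rintro ⟨h1, h2, -, h4⟩
        rw [h1, rlMinL_replicate] at h4
        rw [h1, List.count_replicate_self] at h2
        have := congrArg Multiset.card h4
        simp only [rlMinL, zero_add, Multiset.card_replicate] at this
        rw [this] at h1 h2
        exact ⟨by omega, h1⟩
    | cons x v =>
      have hx : x < m := hv x (by simp)
      have hv' : ∀ y ∈ v, y < m := fun y hy => hv y (by simp [hy])
      rw [cons_mem_insertions_iff]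
      by_cases hzm : z = m
      · subst hzm
        have hne : List.filter (· ≠ z) w = x :: v → ¬ ∀ y ∈ w, z ≤ y := by
          intro h hcon
          have hxw : x ∈ w := List.mem_of_mem_filter (by rw [h]; simp : x ∈ List.filter (· ≠ z) w)
          have := hcon x hxw
          omega
        have h1 : List.filter (· ≠ z) (z :: w) = List.filter (· ≠ z) w := by simp
        rw [h1]
        constructor
        · rintro (⟨h, -⟩ | ⟨-, rfl, c, rfl, h⟩)
          · omega
          · rw [ih hv hw' (by simp)] at h
            obtain ⟨ha, hb, -, hd⟩ := h
            refine ⟨ha, by rw [List.count_cons_self, hb]; ring, by simp, ?_⟩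
            rw [rlMinL, if_neg (hne ha), hd]
        · rintro ⟨ha, hb, hc, hd⟩
          refine Or.inr ⟨rfl, ?_, ?_⟩
          · by_contra h0
            obtain ⟨o, rfl⟩ := Nat.exists_eq_succ_of_ne_zero h0
            simp at hc
          · rw [rlMinL, if_neg (hne ha)] at hd
            rw [List.count_cons_self] at hb
            -- Together with `hb` this gives 1 ≤ c, so that `c - 1` is not truncated.
            have hle : ρ ≤ w.count z := by
              have h3 := Multiset.count_le_of_le z (rlMinL_le w)
              rw [hd, Multiset.count_add, Multiset.count_replicate_self, Multiset.coe_count] at h3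
              omega
            exact ⟨c - 1, by omega, (ih hv hw' (by simp)).2 ⟨ha, by omega, by simp, hd⟩⟩
      · have hzm' : z < m := lt_of_le_of_ne hz hzm
        have h1 : List.filter (· ≠ m) (z :: w) = z :: List.filter (· ≠ m) w := by simp [hzm]
        have hcond : (∀ y ∈ w, z ≤ y) ↔ ∀ y ∈ w.filter (· ≠ m), z ≤ y := by
          simp only [List.mem_filter, decide_eq_true_eq]
          refine ⟨fun h y hy => h y hy.1, fun h y hy => ?_⟩
          by_cases hym : y = m
          · omega
          · exact h y ⟨hy, hym⟩
        have ht : m ∉ (z :: w).take o ↔ m ∉ w.take (o - 1) := by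
          cases o with
          | zero => simp
          | succ o => simp [Ne.symm hzm]
        rw [h1, List.count_cons_of_ne (Ne.symm hzm |>.symm), ht]
        constructor
        · rintro (⟨rfl, h⟩ | ⟨h, -⟩)
          · rw [ih hv' hw' (by simp at ho; omega)] at h
            obtain ⟨ha, hb, hc, hd⟩ := h
            refine ⟨by rw [ha], hb, hc, ?_⟩
            rw [rlMinL, rlMinL, hd]
            simp only [hcond, ha]
            split_ifs <;> simp
          · exact absurd h hzm
        · rintro ⟨ha, hb, hc, hd⟩
          have h2 := (List.cons.inj ha).2
          obtain rfl := (List.cons.inj ha).1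
          refine Or.inl ⟨rfl, (ih hv' hw' (by simp at ho; omega)).2 ⟨h2, hb, hc, ?_⟩⟩
          rw [rlMinL, rlMinL] at hd
          simp only [hcond, h2] at hd
          split_ifs at hd
          · simpa using hd
          · exact hd

/-! ### Removing the largest letter from the words with prescribed minima. -/

section Words

variable (K R : Multiset ℕ)

/-- The words with the letters `≤ m` of `K` whose weak right-to-left minima are the letters
`≤ m` of `R`. -/
def wordsLe (m : ℕ) : Finset (List ℕ) :=
  {w ∈ (K.filter (· ≤ m)).lists.toFinset | rlMinL w = R.filter (· ≤ m)}

variable {K R}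

lemma mem_wordsLe {m : ℕ} {w : List ℕ} :
    w ∈ wordsLe K R m ↔ (w : Multiset ℕ) = K.filter (· ≤ m) ∧ rlMinL w = R.filter (· ≤ m) := by
  rw [wordsLe, Finset.mem_filter, Multiset.mem_toFinset, Multiset.mem_lists_iff]
  exact and_congr_left fun _ => eq_comm

lemma filter_le_succ (K : Multiset ℕ) (m : ℕ) :
    K.filter (· ≤ m + 1) = K.filter (· ≤ m) + Multiset.replicate (K.count (m + 1)) (m + 1) := by
  rw [← Multiset.filter_eq', Multiset.filter_add_filter]
  have h2 : K.filter (fun a => a ≤ m ∧ a = m + 1) = 0 := by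
    rw [Multiset.filter_eq_nil]; intro a _ h; omega
  rw [h2, add_zero]
  exact Multiset.filter_congr fun x _ => by omega

lemma mem_wordsLe_lt {m : ℕ} {v : List ℕ} (hv : v ∈ wordsLe K R m) : ∀ x ∈ v, x < m + 1 := by
  intro x hx
  have : x ∈ (v : Multiset ℕ) := hx
  rw [(mem_wordsLe.1 hv).1, Multiset.mem_filter] at this
  omega

/-- Copies of a largest letter never affect whether a smaller letter is a minimum, so deleting them
removes from the minima just some copies of m + 1. -/
lemma rlMin_eq_add_replicate_iff {m : ℕ} {w : List ℕ} (hw : ∀ x ∈ w, x ≤ m + 1) :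
    rlMinL w = R.filter (· ≤ m + 1) ↔ rlMinL (w.filter (· ≠ m + 1)) = R.filter (· ≤ m) ∧
      rlMinL w = rlMinL (w.filter (· ≠ m + 1)) + Multiset.replicate (R.count (m + 1)) (m + 1) := by
  have key : ∃ ρ, rlMinL w =
      rlMinL (w.filter (· ≠ m + 1)) + Multiset.replicate ρ (m + 1) := by
    induction w with
    | nil => exact ⟨0, by simp⟩
    | cons z w ih =>
      have hz : z ≤ m + 1 := hw z (by simp)
      obtain ⟨ρ, hρ⟩ := ih fun x hx => hw x (by simp [hx])
      by_cases hzm : z = m + 1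
      · subst hzm
        rw [List.filter_cons_of_neg (by simp), rlMinL, hρ]
        split_ifs
        · exact ⟨ρ + 1, by rw [Multiset.replicate_succ, Multiset.add_cons]⟩
        · exact ⟨ρ, rfl⟩
      · rw [List.filter_cons_of_pos (by simpa using hzm), rlMinL, rlMinL, hρ]
        have hcond : (∀ y ∈ w, z ≤ y) ↔ ∀ y ∈ w.filter (· ≠ m + 1), z ≤ y := by
          simp only [List.mem_filter, decide_eq_true_eq]
          refine ⟨fun h y hy => h y hy.1, fun h y hy => ?_⟩
          by_cases hym : y = m + 1
          · omega
          · exact h y ⟨hy, hym⟩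
        simp only [hcond]
        split_ifs
        · exact ⟨ρ, by rw [Multiset.cons_add]⟩
        · exact ⟨ρ, rfl⟩
  have hno : m + 1 ∉ rlMinL (w.filter (· ≠ m + 1)) := fun h => by
    have := Multiset.mem_of_le (rlMinL_le _) h
    simp at this
  rw [filter_le_succ]
  constructor
  · intro h
    obtain ⟨ρ, hρ⟩ := key
    rw [hρ] at h
    have hc := congrArg (Multiset.count (m + 1)) h
    rw [Multiset.count_add, Multiset.count_add, Multiset.count_replicate_self,
      Multiset.count_replicate_self, Multiset.count_eq_zero_of_notMem hno,
      Multiset.count_eq_zero_of_notMem (by simp), zero_add, zero_add] at hc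
    rw [hc] at h hρ
    exact ⟨add_right_cancel h, hρ⟩
  · rintro ⟨h1, h2⟩
    rw [h2, h1]

lemma count_filter_le (K : Multiset ℕ) (m x : ℕ) :
    (K.filter (· ≤ m)).count x = if x ≤ m then K.count x else 0 := by
  rw [Multiset.count_filter]

lemma coe_eq_filter_le_succ_iff {m : ℕ} {w : List ℕ} :
    (w : Multiset ℕ) = K.filter (· ≤ m + 1) ↔
      ((w.filter (· ≠ m + 1) : List ℕ) : Multiset ℕ) = K.filter (· ≤ m) ∧
        w.count (m + 1) = K.count (m + 1) := by
  simp only [Multiset.ext, count_filter_le, Multiset.coe_count]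
  constructor
  · intro h
    refine ⟨fun x => ?_, by simpa using h (m + 1)⟩
    by_cases hx : x = m + 1
    · subst hx
      rw [if_neg (by omega), List.count_eq_zero]
      simp
    · rw [List.count_filter (by simpa using hx), h x]
      exact if_congr (by omega) rfl rfl
  · rintro ⟨h1, h2⟩ x
    by_cases hx : x = m + 1
    · subst hx
      simpa using h2
    · have := h1 x
      rw [List.count_filter (by simpa using hx)] at this
      rw [this]
      exact if_congr (by omega) rfl rfl

lemma mem_wordsLe_succ {m : ℕ} {w : List ℕ} :
    w ∈ wordsLe K R (m + 1) ↔ R.count (m + 1) ≤ K.count (m + 1) ∧ ∃ v ∈ wordsLe K R m,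
      w ∈ insertions (m + 1) (R.count (m + 1)) 0 v (K.count (m + 1) - R.count (m + 1)) := by
  constructor
  · intro h
    have hlt : ∀ x ∈ w, x ≤ m + 1 := fun x hx => by
      have : x ∈ (w : Multiset ℕ) := hx
      rw [(mem_wordsLe.1 h).1, Multiset.mem_filter] at this
      exact this.2
    rw [mem_wordsLe, rlMin_eq_add_replicate_iff hlt, coe_eq_filter_le_succ_iff] at h
    obtain ⟨⟨h1, h2⟩, h3, h4⟩ := h
    have hv : w.filter (· ≠ m + 1) ∈ wordsLe K R m := mem_wordsLe.2 ⟨h1, h3⟩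
    have hle : R.count (m + 1) ≤ K.count (m + 1) := by
      have h5 := Multiset.count_le_of_le (m + 1) (rlMinL_le w)
      rw [h4, Multiset.count_add, Multiset.count_replicate_self, Multiset.coe_count] at h5
      omega
    exact ⟨hle, _, hv, (mem_insertions (mem_wordsLe_lt hv) hlt (by simp)).2
      ⟨rfl, by omega, by simp, h4⟩⟩
  · rintro ⟨hle, v, hv, hw⟩
    have hlt : ∀ x ∈ w, x ≤ m + 1 := by
      have := countP_eq_of_mem_insertions hw (fun x => m + 1 < x) (by simp)
      have h0 : v.countP (fun x => m + 1 < x) = 0 :=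
        List.countP_eq_zero.2 (by simpa using fun x hx => (mem_wordsLe_lt hv x hx).le)
      rw [h0, List.countP_eq_zero] at this
      simpa using this
    rw [mem_insertions (mem_wordsLe_lt hv) hlt (by simp)] at hw
    obtain ⟨h1, h2, -, h4⟩ := hw
    rw [mem_wordsLe, rlMin_eq_add_replicate_iff hlt, coe_eq_filter_le_succ_iff, h1]
    exact ⟨⟨(mem_wordsLe.1 hv).1, by omega⟩, (mem_wordsLe.1 hv).2, h4⟩

lemma sum_wordsLe_succ {A : Type*} [AddCommMonoid A] (m : ℕ) (f : List ℕ → A)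
    (h : R.count (m + 1) ≤ K.count (m + 1)) :
    ∑ w ∈ wordsLe K R (m + 1), f w = ∑ v ∈ wordsLe K R m,
      ∑ w ∈ insertions (m + 1) (R.count (m + 1)) 0 v (K.count (m + 1) - R.count (m + 1)), f w := by
  rw [← Finset.sum_biUnion]
  · refine Finset.sum_congr ?_ fun _ _ => rfl
    ext w
    rw [mem_wordsLe_succ, Finset.mem_biUnion]
    simp [h]
  · intro v hv v' hv' hne
    rw [Function.onFun, Finset.disjoint_left]
    intro w hw hw'
    refine hne ?_
    have hlt (u) (hu : u ∈ wordsLe K R m) (hw : w ∈ insertions (m + 1) (R.count (m + 1)) 0 u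
        (K.count (m + 1) - R.count (m + 1))) : w.filter (· ≠ m + 1) = u := by
      have hlt : ∀ x ∈ w, x ≤ m + 1 := fun x hx => by
        have h1 := mem_wordsLe_succ.2 ⟨h, u, hu, hw⟩
        have : x ∈ (w : Multiset ℕ) := hx
        rw [(mem_wordsLe.1 h1).1, Multiset.mem_filter] at this
        exact this.2
      exact ((mem_insertions (mem_wordsLe_lt hu) hlt (by simp)).1 hw).1
    exact (hlt v hv hw).symm.trans (hlt v' hv' hw')

lemma wordsLe_succ_eq_empty (m : ℕ) (h : K.count (m + 1) < R.count (m + 1)) :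
    wordsLe K R (m + 1) = ∅ :=
  Finset.eq_empty_of_forall_notMem fun w hw => by
    have := (mem_wordsLe_succ.1 hw).1
    omega

end Words

/-! ### The recursion for the generating polynomial of the r-major index. -/

section MajPoly

open Polynomial

variable {A : Type*} [CommRing A]

/-- The number of letters `y` of `K` with `y + r ≤ x`. -/
def lowCount (K : Multiset ℕ) (r x : ℕ) : ℕ := (K.filter (fun y => y + r ≤ x)).card

/-- The number of letters `y` of `K` with `x - r < y < x`. -/
def gapCount (K : Multiset ℕ) (r x : ℕ) : ℕ := (K.filter (fun y => x < y + r ∧ y < x)).card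

lemma lowCount_succ_add_gapCount (K : Multiset ℕ) {r : ℕ} (hr : 1 ≤ r) (m : ℕ) :
    lowCount K r (m + 1) + gapCount K r (m + 1) = (K.filter (· ≤ m)).card := by
  rw [lowCount, gapCount, ← Multiset.card_add, Multiset.filter_add_filter,
    (Multiset.filter_eq_nil (p := fun a => a + r ≤ m + 1 ∧ m + 1 < a + r ∧ a < m + 1)).2
      (fun a _ h => by omega), add_zero]
  congr 1
  exact Multiset.filter_congr fun x _ => by omega

/-- The generating polynomial of the `r`-descent number and the `r`-major index. -/
noncomputable def majPoly (K R : Multiset ℕ) (r : ℕ) (q : A) (m : ℕ) : A[X] :=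
  ∑ w ∈ wordsLe K R m, majWt r (C q) X w

lemma majWt_eq_smul (r : ℕ) (q : A) (w : List ℕ) :
    majWt r (C q) X w = (q ^ majL r w) • (X ^ desL r w : A[X]) := by
  rw [majWt, smul_eq_C_mul, C_pow, mul_comm]

/-- The number of closed spaces of v is `gapCount` plus its number of descents. Hence the insertion
factor depends on v only through the descents, and insertion is a linear operator on the polynomial.
-/
lemma majPoly_succ (K R : Multiset ℕ) {r : ℕ} (hr : 1 ≤ r) (q : A) (m : ℕ)
    (h : R.count (m + 1) ≤ K.count (m + 1)) :
    majPoly K R r q (m + 1) = insertionOp q (lowCount K r (m + 1)) (gapCount K r (m + 1))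
      (K.count (m + 1) - R.count (m + 1)) (majPoly K R r q m) := by
  rw [majPoly, sum_wordsLe_succ m _ h, majPoly, map_sum]
  refine Finset.sum_congr rfl fun v hv => ?_
  rw [sum_majWt_insertions r _ _ _ hr _ _ _ (mem_wordsLe_lt hv), majWt_eq_smul, map_smul,
    insertionOp_X_pow, smul_mul_assoc]
  have hK := (mem_wordsLe.1 hv).1
  have h1 : v.countP (fun y => m + 1 < y + r) = gapCount K r (m + 1) := by
    rw [← Multiset.coe_countP, hK, Multiset.countP_filter, gapCount, Multiset.countP_eq_card_filter]
    congr 1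
    exact Multiset.filter_congr fun x _ => by omega
  have h2 : v.length = lowCount K r (m + 1) + gapCount K r (m + 1) := by
    rw [lowCount_succ_add_gapCount K hr, ← hK, Multiset.coe_card]
  rw [closedSpaces, h1, h2, Nat.add_comm (lowCount K r (m + 1)), Nat.add_sub_add_left]

end MajPoly

/-! ### Replacing placeholders and inserting letters: inversion counts. -/

/-- The number of inversions, by recursion on the word. -/
def invL : List ℕ → ℕ
  | [] => 0
  | x :: w => w.countP (· < x) + invL w

/-- The number of weak inversions whose smaller letter is not `Ω`. -/
def imvOff (Ω : ℕ) : List ℕ → ℕ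
  | [] => 0
  | x :: w => w.countP (fun y => y ≤ x ∧ y ≠ Ω) + imvOff Ω w

/-- The sum of the positions of `true`, where the first position is `s`. -/
def posSum : ℕ → List Bool → ℕ
  | _, [] => 0
  | s, b :: l => (if b then s else 0) + posSum (s + 1) l

/-- The words obtained from `E` by replacing `k` of the letters `Ω` by `m`. -/
def replacements (Ω m : ℕ) : List ℕ → ℕ → Finset (List ℕ)
  | [], 0 => {[]}
  | [], _ + 1 => ∅
  | x :: E, 0 => (replacements Ω m E 0).image (List.cons x)
  | x :: E, k + 1 =>
    if x = Ω then (replacements Ω m E (k + 1)).image (List.cons Ω) ∪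
      (replacements Ω m E k).image (List.cons m)
    else (replacements Ω m E (k + 1)).image (List.cons x)

lemma mem_replacements {Ω m : ℕ} (hm : m ≠ Ω) {E E' : List ℕ} {k : ℕ} (hE : m ∉ E) :
    E' ∈ replacements Ω m E k ↔
      E'.map (fun y => if y = m then Ω else y) = E ∧ E'.count m = k := by
  induction E generalizing E' k with
  | nil =>
    cases k with
    | zero => simp +contextual [replacements]
    | succ k => simp +contextual [replacements]
  | cons x E ih =>
    have hx : x ≠ m := fun h => hE (by simp [h])
    have hE' : m ∉ E := fun h => hE (by simp [h])
    cases E' with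
    | nil => cases k <;> simp [replacements]; split_ifs <;> simp
    | cons z E' =>
      by_cases hz : z = m
      · subst hz
        cases k with
        | zero => simp [replacements, hx]
        | succ k =>
          by_cases hxΩ : x = Ω
          · simp [replacements, hxΩ, ih hE', Ne.symm hm]
          · simp [replacements, hxΩ, hx, Ne.symm hxΩ]
      · cases k with
        | zero => simp [replacements, ih hE', hz]; tauto
        | succ k =>
          by_cases hxΩ : x = Ω
          · simp [replacements, hxΩ, ih hE', hz, Ne.symm hz]; tauto
          · simp [replacements, hxΩ, ih hE', hz]; tauto

lemma countP_of_mem_replacements {Ω m : ℕ} (hm : m ≠ Ω) {E E' : List ℕ} {k : ℕ} (hE : m ∉ E)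
    (h : E' ∈ replacements Ω m E k) (p : ℕ → Prop) [DecidablePred p] (hp : p m ↔ p Ω) :
    E'.countP p = E.countP p := by
  obtain ⟨rfl, -⟩ := (mem_replacements hm hE).1 h
  rw [List.countP_map]
  refine List.countP_congr fun y _ => ?_
  by_cases hy : y = m
  · simp [hy, hp]
  · simp [hy]

lemma length_of_mem_replacements {Ω m : ℕ} (hm : m ≠ Ω) {E E' : List ℕ} {k : ℕ} (hE : m ∉ E)
    (h : E' ∈ replacements Ω m E k) : E'.length = E.length := by
  obtain ⟨rfl, -⟩ := (mem_replacements hm hE).1 h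
  simp

lemma count_of_mem_replacements {Ω m : ℕ} (hm : m ≠ Ω) {E E' : List ℕ} {k : ℕ} (hE : m ∉ E)
    (h : E' ∈ replacements Ω m E k) : E.count Ω = E'.count Ω + k := by
  obtain ⟨rfl, rfl⟩ := (mem_replacements hm hE).1 h
  clear h hE
  induction E' with
  | nil => simp
  | cons z E' ih =>
    by_cases hz : z = m
    · subst hz
      simp [ih, List.count_cons_of_ne hm]; ring
    · by_cases hzΩ : z = Ω
      · simp [hzΩ, Ne.symm hm] at ih ⊢; omega
      · simp [hz, hzΩ] at ih ⊢; omega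

lemma countP_ne_of_mem_replacements {Ω m : ℕ} (hm : m ≠ Ω) {E E' : List ℕ} {k : ℕ} (hE : m ∉ E)
    (h : E' ∈ replacements Ω m E k) :
    E'.countP (· ≠ Ω) = E.countP (· ≠ Ω) + k := by
  have h1 := length_of_mem_replacements hm hE h
  have h2 := count_of_mem_replacements hm hE h
  have h3 (l : List ℕ) : l.length = l.count Ω + l.countP (· ≠ Ω) := by
    rw [List.length_eq_countP_add_countP (· == Ω), List.count]
    congr 1
    refine List.countP_congr fun y _ => by simp
  rw [h3 E', h3 E] at h1
  omega

section Sums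

variable {A : Type*} [CommRing A]

/-- Each new m forms a weak inversion with every earlier Ω or m, so its cost is its rank, from 0,
among the e + k placeholders of E. Summing over k-element subsets gives e_k(1, q, ..., q^(e+k-1)),
which is `replQ q e k`. -/
lemma sum_replacements (q : A) {Ω m : ℕ} (hm : m < Ω) {E : List ℕ}
    (hE : ∀ y ∈ E, y < m ∨ y = Ω) {e k : ℕ} (hc : E.count Ω = e + k) :
    ∑ E' ∈ replacements Ω m E k, q ^ imvOff Ω E' = q ^ imvOff Ω E * replQ q e k := by
  have mem_of {l : List ℕ} (hl : ∀ y ∈ l, y < m ∨ y = Ω) : m ∉ l := fun h => by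
    have := hl m h; omega
  induction E generalizing e k with
  | nil =>
    obtain ⟨rfl, rfl⟩ : e = 0 ∧ k = 0 := by simpa using hc.symm
    simp [replacements, imvOff]
  | cons x E ih =>
    have hE' : ∀ y ∈ E, y < m ∨ y = Ω := fun y hy => hE y (by simp [hy])
    have hmE := mem_of hE'
    have hx : ¬ x = Ω → x < m := fun h => (hE x (by simp)).resolve_right h
    have low {E' : List ℕ} {k : ℕ} (hxΩ : ¬ x = Ω) (h : E' ∈ replacements Ω m E k) :
        imvOff Ω (x :: E') =
          E.countP (fun y => y ≤ x ∧ y ≠ Ω) + imvOff Ω E' := by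
      have := hx hxΩ
      rw [imvOff, countP_of_mem_replacements hm.ne hmE h _ (by omega)]
    have hle (z : ℕ) (hz : m ≤ z) {E' : List ℕ} {k : ℕ} (h : E' ∈ replacements Ω m E k) :
        imvOff Ω (z :: E') = (E.countP (· ≠ Ω) + k) + imvOff Ω E' := by
      rw [imvOff, ← countP_ne_of_mem_replacements hm.ne hmE h]
      congr 1
      refine List.countP_congr fun y hy => ?_
      have hym : y ≤ m ∨ y = Ω := by
        have h1 : (if y = m then Ω else y) ∈ E := by
          rw [← ((mem_replacements hm.ne hmE).1 h).1]
          exact List.mem_map_of_mem (f := fun y => if y = m then Ω else y) hy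
        have h2 := hE' _ h1
        split_ifs at h2 <;> omega
      simp only [decide_eq_true_eq]
      omega
    have hΩ : imvOff Ω (Ω :: E) = E.countP (· ≠ Ω) + imvOff Ω E := by
      rw [imvOff]
      congr 1
      refine List.countP_congr fun y hy => ?_
      have := hE' y hy
      simp only [decide_eq_true_eq]
      omega
    cases k with
    | zero =>
      rw [replacements, sum_image_cons, replQ_zero_right, mul_one]
      by_cases hxΩ : x = Ω
      · subst hxΩ
        rw [List.count_cons_self] at hc
        have h1 := ih hE' (e := e - 1) (k := 0) (by omega)
        rw [replQ_zero_right, mul_one] at h1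
        rw [hΩ, pow_add, ← h1, Finset.mul_sum]
        refine Finset.sum_congr rfl fun E' h => ?_
        rw [hle _ hm.le h, pow_add, add_zero]
      · rw [List.count_cons_of_ne hxΩ] at hc
        have h1 := ih hE' hc
        rw [replQ_zero_right, mul_one] at h1
        rw [imvOff, pow_add, ← h1, Finset.mul_sum]
        refine Finset.sum_congr rfl fun E' h => ?_
        rw [low hxΩ h, pow_add]
    | succ k =>
      by_cases hxΩ : x = Ω
      · subst hxΩ
        rw [List.count_cons_self] at hc
        rw [replacements, if_pos rfl, sum_union_cons hm.ne']
        have h2 : ∑ E' ∈ replacements x m E k, q ^ imvOff x (m :: E') =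
            q ^ imvOff x (x :: E) * (q ^ k * replQ q e k) := by
          rw [hΩ, show q ^ (E.countP (· ≠ x) + imvOff x E) * (q ^ k * replQ q e k) =
            q ^ (E.countP (· ≠ x) + k) * (q ^ imvOff x E * replQ q e k) by ring,
            ← ih hE' (by omega), Finset.mul_sum]
          exact Finset.sum_congr rfl fun E' h => by rw [hle _ le_rfl h, pow_add]
        rw [h2]
        cases e with
        | zero =>
          have h0 : replacements x m E (k + 1) = ∅ :=
            Finset.eq_empty_of_forall_notMem fun E' h => by
              have := count_of_mem_replacements hm.ne hmE h
              omega
          rw [h0, replQ_zero_succ]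
          simp
        | succ e =>
          have h1 : ∑ E' ∈ replacements x m E (k + 1), q ^ imvOff x (x :: E') =
              q ^ imvOff x (x :: E) * (q ^ (k + 1) * replQ q e (k + 1)) := by
            rw [hΩ, show q ^ (E.countP (· ≠ x) + imvOff x E) * (q ^ (k + 1) * replQ q e (k + 1)) =
              q ^ (E.countP (· ≠ x) + (k + 1)) * (q ^ imvOff x E * replQ q e (k + 1)) by ring,
              ← ih hE' (by omega), Finset.mul_sum]
            exact Finset.sum_congr rfl fun E' h => by rw [hle _ hm.le h, pow_add]
          rw [h1, replQ_succ]
          ring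
      · rw [List.count_cons_of_ne hxΩ] at hc
        rw [replacements, if_neg hxΩ, sum_image_cons, imvOff, pow_add, mul_assoc, ← ih hE' hc,
          Finset.mul_sum]
        refine Finset.sum_congr rfl fun E' h => ?_
        rw [low hxΩ h, pow_add]

lemma invL_replicate (n m : ℕ) : invL (List.replicate n m) = 0 := by
  induction n with
  | zero => rfl
  | succ n ih => rw [List.replicate_succ, invL, ih]; simp [List.countP_replicate]

/-- A copy of m costs the number of letters of v behind it, which is any number from 1 to v.length -
o. The ρ copies at the end cost nothing. -/
lemma sum_insertions_inv (q : A) {m ρ o c : ℕ} {v : List ℕ} (hv : ∀ x ∈ v, x < m)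
    (ho : o ≤ v.length) :
    ∑ w ∈ insertions m ρ o v c, q ^ invL w = q ^ invL v * completeQ q (v.length - o) c := by
  have low {x : ℕ} {v w : List ℕ} {o c : ℕ} (hx : x < m) (h : w ∈ insertions m ρ o v c) :
      q ^ invL (x :: w) = q ^ v.countP (· < x) * q ^ invL w := by
    rw [invL, countP_eq_of_mem_insertions h (· < x) (by omega), pow_add]
  induction o, v, c using insertions.induct with
  | case1 o => simp [insertions, invL_replicate, invL]
  | case2 => simp [insertions]
  | case3 x v ih =>
    have hx : x < m := hv x (by simp)
    rw [insertions, sum_image_cons, Finset.sum_congr rfl fun w hw => low hx hw, ← Finset.mul_sum,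
      ih (fun y hy => hv y (by simp [hy])) (by simp), invL]
    simp [pow_add]
  | case4 x v c ih1 ih2 =>
    have hx : x < m := hv x (by simp)
    have hm (w) (h : w ∈ insertions m ρ 0 (x :: v) c) :
        q ^ invL (m :: w) = q ^ (x :: v).length * q ^ invL w := by
      rw [invL, countP_eq_of_mem_insertions h (· < m) (by omega), pow_add,
        List.countP_eq_length.2 (by simpa using hv)]
    rw [insertions, sum_union_cons hx.ne, Finset.sum_congr rfl fun w hw => low hx hw,
      Finset.sum_congr rfl hm, ← Finset.mul_sum, ← Finset.mul_sum,
      ih1 (fun y hy => hv y (by simp [hy])) (by simp), ih2 hv (by simp), invL]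
    simp only [List.length_cons, Nat.sub_zero, completeQ_succ]
    ring
  | case5 o x v c ih =>
    have hx : x < m := hv x (by simp)
    rw [insertions, sum_image_cons, Finset.sum_congr rfl fun w hw => low hx hw, ← Finset.mul_sum,
      ih (fun y hy => hv y (by simp [hy])) (by simpa using ho), invL]
    simp [pow_add, mul_assoc]

end Sums

lemma posSum_append (s : ℕ) (l : List Bool) (b : Bool) :
    posSum s (l ++ [b]) = posSum s l + if b then s + l.length else 0 := by
  induction l generalizing s with
  | nil => simp [posSum]
  | cons a l ih =>
    rw [List.cons_append, posSum, ih, posSum, List.length_cons]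
    split_ifs <;> omega

lemma imvOff_append_self (Ω : ℕ) (E : List ℕ) : imvOff Ω (E ++ [Ω]) = imvOff Ω E := by
  induction E with
  | nil => simp [imvOff]
  | cons x E ih => rw [List.cons_append, imvOff, ih, imvOff, List.countP_append]; simp

/-! ### States: partially filled words with placeholders. -/

/-- A pattern `β` of `p` positions, a word `E` filling the positions marked `true`, and a word
`N` which first fills the positions marked `false`. The letters `≤ m` of `K` are distributed over
`E` and `N`, and `E` contains `e` letters `Ω` that stand for larger letters. -/
structure IsState (K R : Multiset ℕ) (r Ω m p e : ℕ) (s : List Bool × List ℕ × List ℕ) :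
    Prop where
  length_eq : s.1.length = p
  count_eq : s.1.count true = s.2.1.length
  content_eq : (s.2.1 : Multiset ℕ) + (s.2.2 : Multiset ℕ) =
    K.filter (· ≤ m) + Multiset.replicate e Ω
  notMem : Ω ∉ s.2.2
  rlMin_eq : rlMinL s.2.2 = R.filter (· ≤ m)
  lt_of_mem_drop : ∀ x ≤ m, ∀ y ∈ s.2.1.drop ((s.1.take (lowCount K r x)).count true), x < y
  lt_of_mem_take : ∀ x ≤ m, ∀ y ∈ s.2.2.take ((s.1.take (lowCount K r x)).count false), y < x

/-- The finite set of all words on letters of `M`. -/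
def subWords {α : Type*} [DecidableEq α] (M : Multiset α) : Finset (List α) :=
  (M.powerset.bind Multiset.lists).toFinset

lemma mem_subWords {α : Type*} [DecidableEq α] {M : Multiset α} {l : List α} :
    l ∈ subWords M ↔ (l : Multiset α) ≤ M := by
  simp [subWords, Multiset.mem_bind, Multiset.mem_lists_iff]

open Classical in
/-- The finite set of states. -/
noncomputable def states (K R : Multiset ℕ) (r Ω m p e : ℕ) :
    Finset (List Bool × List ℕ × List ℕ) :=
  {s ∈ subWords (Multiset.replicate p true + Multiset.replicate p false) ×ˢ
    subWords (K + Multiset.replicate e Ω) ×ˢ subWords (K + Multiset.replicate e Ω) |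
      IsState K R r Ω m p e s}

variable {K R : Multiset ℕ} {r Ω m p e : ℕ} {s : List Bool × List ℕ × List ℕ}

lemma mem_states : s ∈ states K R r Ω m p e ↔ IsState K R r Ω m p e s := by
  classical
  rw [states, Finset.mem_filter, and_iff_right_iff_imp]
  intro h
  have hle : K.filter (· ≤ m) + Multiset.replicate e Ω ≤ K + Multiset.replicate e Ω :=
    add_le_add_left (Multiset.filter_le _ _) _
  rw [Finset.mem_product, Finset.mem_product, mem_subWords, mem_subWords, mem_subWords]
  refine ⟨?_, ?_, ?_⟩
  · rw [Multiset.le_iff_count]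
    intro b
    have := List.count_le_length (l := s.1) (a := b)
    rw [h.length_eq] at this
    cases b <;> simp [Multiset.count_replicate, this]
  · exact (Multiset.le_add_right _ _).trans (h.content_eq.le.trans hle)
  · exact (Multiset.le_add_left _ _).trans (h.content_eq.le.trans hle)

namespace IsState

lemma length_add_length (h : IsState K R r Ω m p e s) :
    s.2.1.length + s.2.2.length = (K.filter (· ≤ m)).card + e := by
  have := congrArg Multiset.card h.content_eq
  simpa using this

lemma count_false (h : IsState K R r Ω m p e s) : s.1.count false + s.2.1.length = p := by
  have := List.count_not_add_count s.1 true
  rw [h.length_eq, h.count_eq] at this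
  simpa using this

lemma mem_E (h : IsState K R r Ω m p e s) {y : ℕ} (hy : y ∈ s.2.1) : y ≤ m ∨ y = Ω := by
  have : y ∈ K.filter (· ≤ m) + Multiset.replicate e Ω := by
    rw [← h.content_eq]; exact Multiset.mem_add.2 (Or.inl hy)
  rw [Multiset.mem_add, Multiset.mem_filter, Multiset.mem_replicate] at this
  tauto

lemma mem_N (h : IsState K R r Ω m p e s) {y : ℕ} (hy : y ∈ s.2.2) : y ≤ m := by
  have : y ∈ K.filter (· ≤ m) + Multiset.replicate e Ω := by
    rw [← h.content_eq]; exact Multiset.mem_add.2 (Or.inr hy)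
  rw [Multiset.mem_add, Multiset.mem_filter, Multiset.mem_replicate] at this
  have h2 : y ≠ Ω := fun h' => h.notMem (h' ▸ hy)
  tauto

lemma count_Ω (h : IsState K R r Ω m p e s) (hm : m < Ω) : s.2.1.count Ω = e := by
  have := congrArg (Multiset.count Ω) h.content_eq
  rw [Multiset.count_add, Multiset.coe_count, Multiset.coe_count,
    List.count_eq_zero_of_not_mem h.notMem, Multiset.count_add, count_filter_le,
    if_neg (by omega), Multiset.count_replicate_self] at this
  omega

end IsState

/-! ### Opening a new position. -/

section Open

/-- The conditions at x ≤ m cut the pattern after at most p positions, so they do not see the new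
one. -/
lemma isState_append_false (hp : lowCount K r m ≤ p) {β : List Bool} {E N : List ℕ}
    (hβ : β.length = p) :
    IsState K R r Ω m (p + 1) e (β ++ [false], E, N) ↔ IsState K R r Ω m p e (β, E, N) := by
  have ht (x) (hx : x ≤ m) : (β ++ [false]).take (lowCount K r x) = β.take (lowCount K r x) := by
    refine List.take_append_of_le_length ?_
    rw [hβ]
    refine le_trans (Multiset.card_le_card (Multiset.monotone_filter_right K ?_)) hp
    intro y hy; omega
  constructor
  · rintro ⟨h1, h2, h3, h4, h5, h6, h7⟩
    exact ⟨hβ, by simpa using h2, h3, h4, h5, fun x hx => by simpa [ht x hx] using h6 x hx,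
      fun x hx => by simpa [ht x hx] using h7 x hx⟩
  · rintro ⟨h1, h2, h3, h4, h5, h6, h7⟩
    exact ⟨by simp [hβ], by simpa using h2, h3, h4, h5,
      fun x hx => by simpa [ht x hx] using h6 x hx, fun x hx => by simpa [ht x hx] using h7 x hx⟩

lemma isState_append_true (hp : lowCount K r m ≤ p) (hm : m < Ω) {β : List Bool} {E N : List ℕ}
    (hβ : β.length = p) :
    IsState K R r Ω m (p + 1) (e + 1) (β ++ [true], E ++ [Ω], N) ↔
      IsState K R r Ω m p e (β, E, N) := by
  have ht (x) (hx : x ≤ m) : (β ++ [true]).take (lowCount K r x) = β.take (lowCount K r x) := by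
    refine List.take_append_of_le_length ?_
    rw [hβ]
    refine le_trans (Multiset.card_le_card (Multiset.monotone_filter_right K ?_)) hp
    intro y hy; omega
  have hcont : ((E ++ [Ω] : List ℕ) : Multiset ℕ) + (N : Multiset ℕ) =
      K.filter (· ≤ m) + Multiset.replicate (e + 1) Ω ↔ (E : Multiset ℕ) + (N : Multiset ℕ) =
      K.filter (· ≤ m) + Multiset.replicate e Ω := by
    rw [← Multiset.coe_add, Multiset.coe_singleton, add_right_comm, Multiset.replicate_succ,
      ← Multiset.singleton_add, add_left_comm,
      add_comm _ ({Ω} : Multiset ℕ), add_right_inj]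
  have hdrop (x) (hx : x ≤ m) (hc : β.count true = E.length) :
      (∀ y ∈ (E ++ [Ω]).drop ((β.take (lowCount K r x)).count true), x < y) ↔
      ∀ y ∈ E.drop ((β.take (lowCount K r x)).count true), x < y := by
    rw [List.drop_append_of_le_length]
    · simp only [List.mem_append, List.mem_singleton]
      refine ⟨fun h y hy => h y (Or.inl hy), ?_⟩
      rintro h y (hy | rfl)
      · exact h y hy
      · omega
    · rw [← hc]
      exact (List.take_sublist _ _).count_le _
  constructor
  · rintro ⟨h1, h2, h3, h4, h5, h6, h7⟩
    have hc : β.count true = E.length := by simpa using h2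
    refine ⟨hβ, hc, hcont.1 h3, h4, h5, fun x hx => ?_, fun x hx => ?_⟩
    · have := h6 x hx
      simp only [ht x hx] at this
      exact (hdrop x hx hc).1 this
    · simpa [ht x hx] using h7 x hx
  · rintro ⟨h1, h2, h3, h4, h5, h6, h7⟩
    refine ⟨by simp [hβ], by simpa using h2, hcont.2 h3, h4, h5, fun x hx => ?_, fun x hx => ?_⟩
    · simp only [ht x hx]
      exact (hdrop x hx h2).2 (h6 x hx)
    · simpa [ht x hx] using h7 x hx

lemma exists_append_of_isState (hp : lowCount K r m ≤ p)
    (h : IsState K R r Ω m (p + 1) e s) :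
    (∃ β E N, s = (β ++ [false], E, N) ∧ β.length = p) ∨
      ∃ β E N, s = (β ++ [true], E ++ [Ω], N) ∧ β.length = p ∧ 1 ≤ e := by
  obtain ⟨β', E', N⟩ := s
  obtain rfl | ⟨β, b, rfl⟩ := List.eq_nil_or_concat' β'
  · have := h.length_eq; simp at this
  have hβ : β.length = p := by simpa using h.length_eq
  cases b with
  | false => exact Or.inl ⟨β, E', N, rfl, hβ⟩
  | true =>
    right
    have hc := h.count_eq
    simp only [List.count_append, List.count_singleton_self] at hc
    obtain rfl | ⟨E, z, rfl⟩ := List.eq_nil_or_concat' E'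
    · simp at hc
    have hcE : β.count true = E.length := by simpa using hc
    -- The last position lies beyond `lowCount K r m`, so the condition at x = m applies to its
    -- letter; a letter of E above m can only be Ω.
    have hz : m < z := by
      refine h.lt_of_mem_drop m le_rfl z ?_
      simp only []
      rw [List.take_append_of_le_length (by omega), List.drop_append_of_le_length]
      · simp
      · rw [← hcE]
        exact (List.take_sublist _ _).count_le _
    obtain rfl : z = Ω := by
      rcases h.mem_E (y := z) (by simp) with h | h
      · omega
      · exact h
    refine ⟨β, E, N, rfl, hβ, ?_⟩
    have h1 := h.count_Ω hz
    simp at h1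
    omega

end Open

/-! ### Inserting the copies of one letter into a state. -/

section Letter

/-- Forget the distinction between the letters `m` and `Ω` in `E`, and delete `m` from `N`. -/
def forget (Ω m : ℕ) (s : List Bool × List ℕ × List ℕ) : List Bool × List ℕ × List ℕ :=
  (s.1, s.2.1.map (fun y => if y = m then Ω else y), s.2.2.filter (· ≠ m))

lemma take_filter_ne {α : Type*} [DecidableEq α] {a : α} {l : List α} {i j : ℕ} (hij : i ≤ j)
    (h : a ∉ l.take j) : (l.filter (· ≠ a)).take i = l.take i := by
  induction l generalizing i j with
  | nil => simp
  | cons x l ih =>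
    cases i with
    | zero => simp
    | succ i =>
      obtain ⟨j, rfl⟩ := Nat.exists_eq_succ_of_ne_zero (by omega : j ≠ 0)
      rw [List.take_succ_cons, List.mem_cons, not_or] at h
      rw [List.filter_cons_of_pos (by simpa using Ne.symm h.1), List.take_succ_cons,
        List.take_succ_cons, ih (by omega) h.2]

lemma content_forget_iff (hΩ : m + 1 < Ω) {E N : List ℕ} (hN : Ω ∉ N) :
    (E : Multiset ℕ) + (N : Multiset ℕ) = K.filter (· ≤ m + 1) + Multiset.replicate e Ω ↔
      ((E.map (fun y => if y = m + 1 then Ω else y) : List ℕ) : Multiset ℕ) +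
          ((N.filter (· ≠ m + 1) : List ℕ) : Multiset ℕ) =
        K.filter (· ≤ m) + Multiset.replicate (e + E.count (m + 1)) Ω ∧
      E.count (m + 1) + N.count (m + 1) = K.count (m + 1) := by
  have hmap (x : ℕ) : (E.map (fun y => if y = m + 1 then Ω else y)).count x =
      (if x = m + 1 then 0 else E.count x) + if x = Ω then E.count (m + 1) else 0 := by
    clear hN
    induction E with
    | nil => simp
    | cons z E ih =>
      rw [List.map_cons, List.count_cons, ih, List.count_cons, List.count_cons]
      simp only [beq_iff_eq]
      split_ifs <;> omega
  have hfil (x : ℕ) : (N.filter (· ≠ m + 1)).count x = if x = m + 1 then 0 else N.count x := by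
    split_ifs with h
    · rw [List.count_eq_zero]; simp [h]
    · rw [List.count_filter (by simpa using h)]
  have hN0 : N.count Ω = 0 := List.count_eq_zero_of_not_mem hN
  simp only [Multiset.ext, Multiset.count_add, count_filter_le, Multiset.count_replicate,
    Multiset.coe_count, hmap, hfil]
  constructor
  · intro h
    refine ⟨fun x => ?_, ?_⟩
    · have := h x
      split_ifs at this ⊢ <;> try omega
    · have := h (m + 1)
      split_ifs at this <;> omega
  · rintro ⟨h1, h2⟩ x
    have := h1 x
    by_cases hx : x = m + 1
    · subst hx
      rw [if_pos le_rfl, if_neg (by omega), add_zero]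
      exact h2
    · split_ifs at this ⊢ <;> omega

/-- Because p = `lowCount K r (m + 1)`, the new condition at x = m + 1 is void for E and says for N
that no m + 1 stands in a position of the pattern. The old conditions do not distinguish m + 1 from
Ω. -/
lemma isState_succ_iff (hΩ : m + 1 < Ω) (hp : lowCount K r (m + 1) = p) :
    IsState K R r Ω (m + 1) p e s ↔
      IsState K R r Ω m p (e + s.2.1.count (m + 1)) (forget Ω (m + 1) s) ∧
      s.2.1.count (m + 1) + s.2.2.count (m + 1) = K.count (m + 1) ∧
      m + 1 ∉ s.2.2.take (s.1.count false) ∧ Ω ∉ s.2.2 ∧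
      (∀ y ∈ s.2.2, y ≤ m + 1) ∧
      rlMinL s.2.2 = rlMinL (s.2.2.filter (· ≠ m + 1)) +
        Multiset.replicate (R.count (m + 1)) (m + 1) := by
  obtain ⟨β, E, N⟩ := s
  simp only [forget]
  have hdrop (x) (hx : x ≤ m) (j : ℕ) :
      (∀ y ∈ (E.map (fun y => if y = m + 1 then Ω else y)).drop j, x < y) ↔
        ∀ y ∈ E.drop j, x < y := by
    rw [← List.map_drop]
    simp only [List.mem_map, forall_exists_index, and_imp, forall_apply_eq_imp_iff₂]
    refine forall₂_congr fun y _ => ?_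
    split_ifs <;> omega
  have htake (hno : m + 1 ∉ N.take (β.count false)) (x : ℕ) :
      (N.filter (· ≠ m + 1)).take ((β.take (lowCount K r x)).count false) =
        N.take ((β.take (lowCount K r x)).count false) :=
    take_filter_ne ((List.take_sublist _ _).count_le _) hno
  constructor
  · intro h
    have hN (y) (hy : y ∈ N) : y ≤ m + 1 := h.mem_N hy
    have h1 := (content_forget_iff hΩ h.notMem).1 h.content_eq
    have h2 := (rlMin_eq_add_replicate_iff hN).1 h.rlMin_eq
    have hno : m + 1 ∉ N.take (β.count false) := fun hmem => by
      have := h.lt_of_mem_take (m + 1) le_rfl (m + 1)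
      simp only [] at this
      rw [show β.take (lowCount K r (m + 1)) = β from
        List.take_of_length_le (by rw [hp]; exact h.length_eq.le)] at this
      exact lt_irrefl _ (this hmem)
    refine ⟨⟨h.length_eq, by simpa using h.count_eq, h1.1, ?_, h2.1, fun x hx => ?_,
      fun x hx => ?_⟩, h1.2, hno, h.notMem, hN, h2.2⟩
    · intro hmem
      exact h.notMem (List.mem_of_mem_filter hmem)
    · exact (hdrop x hx _).2 (h.lt_of_mem_drop x (by omega))
    · simp only [htake hno]
      exact h.lt_of_mem_take x (by omega)
  · rintro ⟨h, h2, hno, hΩN, hN, h3⟩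
    refine ⟨h.length_eq, by simpa using h.count_eq, (content_forget_iff hΩ hΩN).2
      ⟨h.content_eq, h2⟩, hΩN, (rlMin_eq_add_replicate_iff hN).2 ⟨h.rlMin_eq, h3⟩,
      fun x hx => ?_, fun x hx => ?_⟩
    · rcases Nat.lt_or_ge m x with hx' | hx'
      · obtain rfl : x = m + 1 := by omega
        simp only []
        rw [List.take_of_length_le (by rw [hp]; exact h.length_eq.le), List.drop_of_length_le]
        · simp
        · have := h.count_eq
          simp only [List.length_map] at this
          exact this.ge
      · exact (hdrop x hx' _).1 (h.lt_of_mem_drop x hx')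
    · rcases Nat.lt_or_ge m x with hx' | hx'
      · obtain rfl : x = m + 1 := by omega
        simp only []
        rw [show β.take (lowCount K r (m + 1)) = β from
          List.take_of_length_le (by rw [hp]; exact h.length_eq.le)]
        intro y hy
        exact lt_of_le_of_ne (hN y (List.mem_of_mem_take hy)) fun h' => hno (h' ▸ hy)
      · have := h.lt_of_mem_take x hx'
        simp only [htake hno] at this
        exact this

end Letter

variable {K R : Multiset ℕ} {r Ω m p e : ℕ} {s : List Bool × List ℕ × List ℕ}

/-- The total contribution of the letters of `E` to the gap part of the Denert statistic. -/
def gapSum (K : Multiset ℕ) (r Ω : ℕ) (E : List ℕ) : ℕ :=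
  (E.map fun x => if x = Ω then 0 else gapCount K r x).sum

/-! ### Weights of states and their two recurrences. -/

section Weights

variable {A : Type*} [CommRing A]

/-- The monomial recording the number of `r`-excedances and the `r`-gap Denert statistic. -/
def denWt (K : Multiset ℕ) (r Ω : ℕ) (q t : A) (s : List Bool × List ℕ × List ℕ) : A :=
  t ^ s.2.1.length * q ^ (posSum 1 s.1 + gapSum K r Ω s.2.1 + imvOff Ω s.2.1 + invL s.2.2)

/-- The generating function of the states. -/
noncomputable def stateSum (K R : Multiset ℕ) (r Ω : ℕ) (q t : A) (m p e : ℕ) : A :=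
  ∑ s ∈ states K R r Ω m p e, denWt K r Ω q t s

lemma denWt_append_false (q t : A) (β : List Bool) (E N : List ℕ) :
    denWt K r Ω q t (β ++ [false], E, N) = denWt K r Ω q t (β, E, N) := by
  simp [denWt, posSum_append]

lemma denWt_append_true (q t : A) (β : List Bool) (E N : List ℕ) :
    denWt K r Ω q t (β ++ [true], E ++ [Ω], N) =
      t * q ^ (β.length + 1) * denWt K r Ω q t (β, E, N) := by
  have h : gapSum K r Ω (E ++ [Ω]) = gapSum K r Ω E := by simp [gapSum]
  simp only [denWt, posSum_append, imvOff_append_self, h, List.length_append, List.length_singleton,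
    if_true]
  ring

lemma append_false_injective : Function.Injective
    fun s : List Bool × List ℕ × List ℕ => (s.1 ++ [false], s.2) := by
  rintro ⟨a, b⟩ ⟨a', b'⟩ h
  simpa using h

lemma append_true_injective (Ω : ℕ) : Function.Injective
    fun s : List Bool × List ℕ × List ℕ => (s.1 ++ [true], s.2.1 ++ [Ω], s.2.2) := by
  rintro ⟨a, b, c⟩ ⟨a', b', c'⟩ h
  simpa using h

lemma sum_denWt_append_false (q t : A) :
    ∑ s ∈ (states K R r Ω m p e).image (fun s => (s.1 ++ [false], s.2)), denWt K r Ω q t s =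
      stateSum K R r Ω q t m p e := by
  rw [Finset.sum_image append_false_injective.injOn]
  exact Finset.sum_congr rfl fun s _ => denWt_append_false q t s.1 s.2.1 s.2.2

lemma stateSum_open_zero (hp : lowCount K r m ≤ p) (q t : A) :
    stateSum K R r Ω q t m (p + 1) 0 = stateSum K R r Ω q t m p 0 := by
  rw [← sum_denWt_append_false (p := p), stateSum]
  refine Finset.sum_congr ?_ fun _ _ => rfl
  ext s
  simp only [Finset.mem_image, mem_states]
  constructor
  · intro h
    obtain ⟨β, E, N, rfl, hβ⟩ | ⟨_, _, _, _, _, h'⟩ := exists_append_of_isState hp h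
    · exact ⟨(β, E, N), (isState_append_false hp hβ).1 h, rfl⟩
    · omega
  · rintro ⟨⟨β, E, N⟩, h, rfl⟩
    exact (isState_append_false hp h.length_eq).2 h

/-- A placeholder at position p + 1 contributes one excedance and its position. It has no weak
inversions yet: `imvOff` ignores pairs whose smaller letter is Ω, and they are paid for once the
placeholder is replaced. -/
lemma stateSum_open_succ (hp : lowCount K r m ≤ p) (hm : m < Ω) (q t : A) :
    stateSum K R r Ω q t m (p + 1) (e + 1) = stateSum K R r Ω q t m p (e + 1) +
      t * q ^ (p + 1) * stateSum K R r Ω q t m p e := by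
  have h2 : ∑ s ∈ (states K R r Ω m p e).image (fun s => (s.1 ++ [true], s.2.1 ++ [Ω], s.2.2)),
      denWt K r Ω q t s = t * q ^ (p + 1) * stateSum K R r Ω q t m p e := by
    rw [Finset.sum_image (append_true_injective Ω).injOn, stateSum, Finset.mul_sum]
    refine Finset.sum_congr rfl fun s hs => ?_
    rw [denWt_append_true, (mem_states.1 hs).length_eq]
  rw [← h2, ← sum_denWt_append_false (p := p), ← Finset.sum_union, stateSum]
  · refine Finset.sum_congr ?_ fun _ _ => rfl
    ext s
    simp only [Finset.mem_union, Finset.mem_image, mem_states]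
    constructor
    · intro h
      obtain ⟨β, E, N, rfl, hβ⟩ | ⟨β, E, N, rfl, hβ, -⟩ := exists_append_of_isState hp h
      · exact Or.inl ⟨(β, E, N), (isState_append_false hp hβ).1 h, rfl⟩
      · exact Or.inr ⟨(β, E, N), (isState_append_true hp hm hβ).1 h, rfl⟩
    · rintro (⟨⟨β, E, N⟩, h, rfl⟩ | ⟨⟨β, E, N⟩, h, rfl⟩)
      · exact (isState_append_false hp h.length_eq).2 h
      · exact (isState_append_true hp hm h.length_eq).2 h
  · rw [Finset.disjoint_left]
    simp only [Finset.mem_image, not_exists, not_and]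
    rintro _ ⟨s, -, rfl⟩ s' - h
    have := congrArg (fun s => s.1.getLast?) h
    simp at this

/-- The states obtained from `s` by replacing `k` letters `Ω` of `E` by `m` and inserting `l`
further letters `m` in `N`, before appending `ρ` of them. -/
def fillings (Ω m ρ : ℕ) (s : List Bool × List ℕ × List ℕ) (k l : ℕ) :
    Finset (List Bool × List ℕ × List ℕ) :=
  (replacements Ω m s.2.1 k ×ˢ insertions m ρ (s.1.count false) s.2.2 l).image fun z => (s.1, z)

lemma mem_fillings {ρ k l : ℕ} {s s' : List Bool × List ℕ × List ℕ} :
    s' ∈ fillings Ω m ρ s k l ↔ s'.1 = s.1 ∧ s'.2.1 ∈ replacements Ω m s.2.1 k ∧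
      s'.2.2 ∈ insertions m ρ (s.1.count false) s.2.2 l := by
  obtain ⟨β, E, N⟩ := s
  obtain ⟨β', E', N'⟩ := s'
  simp only [fillings, Finset.mem_image, Finset.mem_product, Prod.mk.injEq, Prod.exists]
  constructor
  · rintro ⟨a, b, ⟨h1, h2⟩, rfl, rfl, rfl⟩
    exact ⟨rfl, h1, h2⟩
  · rintro ⟨rfl, h1, h2⟩
    exact ⟨E', N', ⟨h1, h2⟩, rfl, rfl, rfl⟩

lemma IsState.count_false_le (h : IsState K R r Ω m p e s)
    (hp : p ≤ (K.filter (· ≤ m)).card) : s.1.count false ≤ s.2.2.length := by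
  have h1 := h.length_add_length
  have h2 := h.count_false
  omega

lemma fillings_facts {k l : ℕ} {s s' : List Bool × List ℕ × List ℕ}
    (hΩ : m + 1 < Ω) (hs : IsState K R r Ω m p e s) (hp : p ≤ (K.filter (· ≤ m)).card)
    {ρ : ℕ} (h : s' ∈ fillings Ω (m + 1) ρ s k l) :
    s = forget Ω (m + 1) s' ∧ s'.2.1.count (m + 1) = k ∧ s'.2.2.count (m + 1) = l + ρ ∧
      m + 1 ∉ s'.2.2.take (s.1.count false) ∧ (∀ y ∈ s'.2.2, y ≤ m + 1) ∧
      rlMinL s'.2.2 = rlMinL s.2.2 + Multiset.replicate ρ (m + 1) := by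
  obtain ⟨h1, h2, h3⟩ := mem_fillings.1 h
  have hE : m + 1 ∉ s.2.1 := fun hmem => by
    rcases hs.mem_E hmem with h | h <;> omega
  have hN : ∀ x ∈ s.2.2, x < m + 1 := fun x hx => by have := hs.mem_N hx; omega
  have hlt : ∀ x ∈ s'.2.2, x ≤ m + 1 := by
    have := countP_eq_of_mem_insertions h3 (fun x => m + 1 < x) (by simp)
    have h0 : s.2.2.countP (fun x => m + 1 < x) = 0 :=
      List.countP_eq_zero.2 (by simpa using fun x hx => (hN x hx).le)
    rw [h0, List.countP_eq_zero] at this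
    simpa using this
  rw [mem_replacements hΩ.ne hE] at h2
  rw [mem_insertions hN hlt (hs.count_false_le hp)] at h3
  refine ⟨?_, h2.2, h3.2.1, h3.2.2.1, hlt, h3.2.2.2⟩
  rw [forget, h1, h2.1, h3.1]

lemma states_succ_eq (hΩ : m + 1 < Ω) (hp : lowCount K r (m + 1) = p)
    (hpK : p ≤ (K.filter (· ≤ m)).card) (h : R.count (m + 1) ≤ K.count (m + 1)) :
    states K R r Ω (m + 1) p e =
      ((antidiagonal (K.count (m + 1) - R.count (m + 1))).sigma
        fun x => states K R r Ω m p (e + x.1)).biUnion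
        fun z => fillings Ω (m + 1) (R.count (m + 1)) z.2 z.1.1 z.1.2 := by
  ext s
  simp only [Finset.mem_biUnion, Finset.mem_sigma, mem_states]
  constructor
  · intro hs
    obtain ⟨h1, h2, h3, h4, h5, h6⟩ := (isState_succ_iff hΩ hp).1 hs
    have hle : R.count (m + 1) ≤ s.2.2.count (m + 1) := by
      have h7 := Multiset.count_le_of_le (m + 1) (rlMinL_le s.2.2)
      rw [h6, Multiset.count_add, Multiset.count_replicate_self, Multiset.coe_count] at h7
      omega
    refine ⟨⟨(s.2.1.count (m + 1), s.2.2.count (m + 1) - R.count (m + 1)), forget Ω (m + 1) s⟩,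
      ⟨HasAntidiagonal.mem_antidiagonal.2 (by simp only []; omega), h1⟩, mem_fillings.2 ⟨rfl, ?_, ?_⟩⟩
    · rw [mem_replacements hΩ.ne]
      · exact ⟨rfl, rfl⟩
      · intro hmem
        rcases h1.mem_E hmem with h | h <;> omega
    · rw [mem_insertions (fun x hx => by have := h1.mem_N hx; omega) h5 (h1.count_false_le hpK)]
      exact ⟨rfl, by simp only []; omega, h3, h6⟩
  · rintro ⟨⟨⟨k, l⟩, s₀⟩, ⟨hkl, hs₀⟩, hs⟩
    simp only [HasAntidiagonal.mem_antidiagonal] at hkl hs₀ hs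
    obtain ⟨rfl, h2, h3, h4, h5, h6⟩ := fillings_facts hΩ hs₀ hpK hs
    rw [isState_succ_iff hΩ hp]
    refine ⟨by rw [h2]; exact hs₀, by omega, h4, fun hmem => ?_, h5, h6⟩
    have := h5 _ hmem
    omega

lemma sum_states_succ (hΩ : m + 1 < Ω) (hp : lowCount K r (m + 1) = p)
    (hpK : p ≤ (K.filter (· ≤ m)).card) (h : R.count (m + 1) ≤ K.count (m + 1))
    (f : List Bool × List ℕ × List ℕ → A) :
    ∑ s ∈ states K R r Ω (m + 1) p e, f s =
      ∑ x ∈ antidiagonal (K.count (m + 1) - R.count (m + 1)),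
        ∑ s ∈ states K R r Ω m p (e + x.1),
          ∑ s' ∈ fillings Ω (m + 1) (R.count (m + 1)) s x.1 x.2, f s' := by
  rw [states_succ_eq hΩ hp hpK h, Finset.sum_biUnion, Finset.sum_sigma]
  rintro ⟨⟨k, l⟩, s⟩ hz ⟨⟨k', l'⟩, s'⟩ hz' hne
  rw [Function.onFun, Finset.disjoint_left]
  intro w hw hw'
  simp only [Finset.coe_sigma, Set.mem_sigma_iff, Finset.mem_coe, mem_states] at hz hz'
  obtain ⟨h1, h2, h3, -⟩ := fillings_facts hΩ hz.2 hpK hw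
  obtain ⟨h1', h2', h3', -⟩ := fillings_facts hΩ hz'.2 hpK hw'
  refine hne ?_
  simp only [] at h1 h1' h2 h2' h3 h3'
  obtain rfl : k = k' := by omega
  obtain rfl : l = l' := by omega
  rw [h1, h1']

lemma gapSum_of_mem_replacements {k : ℕ} {E E' : List ℕ} (hm : m ≠ Ω) (hE : m ∉ E)
    (h : E' ∈ replacements Ω m E k) :
    gapSum K r Ω E' = gapSum K r Ω E + k * gapCount K r m := by
  obtain ⟨rfl, rfl⟩ := (mem_replacements hm hE).1 h
  clear h hE
  induction E' with
  | nil => simp [gapSum]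
  | cons z E' ih =>
    simp only [gapSum, List.map_cons, List.sum_cons] at ih ⊢
    rw [ih]
    by_cases hz : z = m
    · subst hz
      rw [if_neg hm, if_pos rfl, if_pos rfl, List.count_cons_self]
      ring
    · rw [if_neg hz, List.count_cons_of_ne hz]
      ring

lemma sum_fillings {k l ρ : ℕ} (hΩ : m + 1 < Ω) (hs : IsState K R r Ω m p (e + k) s) {b : ℕ}
    (hpb : p + b = (K.filter (· ≤ m)).card) (q t : A) :
    ∑ s' ∈ fillings Ω (m + 1) ρ s k l, denWt K r Ω q t s' =
      q ^ (k * gapCount K r (m + 1)) * replQ q e k * completeQ q (b + e + k) l *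
        denWt K r Ω q t s := by
  have hE : m + 1 ∉ s.2.1 := fun hmem => by
    rcases hs.mem_E hmem with h | h <;> omega
  have hlow : ∀ x ∈ s.2.2, x < m + 1 := fun x hx => by have := hs.mem_N hx; omega
  have h1 := sum_replacements q hΩ (E := s.2.1) (e := e) (k := k)
    (fun y hy => by rcases hs.mem_E hy with h | h <;> omega) (hs.count_Ω (by omega))
  have h2 := sum_insertions_inv q (ρ := ρ) (c := l) hlow (hs.count_false_le (by omega))
  -- Letters of N not yet placed in the pattern: E and N have p + b + e + k letters in total, and p
  -- of them fill the pattern.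
  have h3 : s.2.2.length - s.1.count false = b + e + k := by
    have h1 := hs.length_add_length
    have h2 := hs.count_false
    omega
  rw [h3] at h2
  rw [fillings, Finset.sum_image (fun _ _ _ _ h => (Prod.mk.inj h).2), Finset.sum_product]
  have key (E') (hE' : E' ∈ replacements Ω (m + 1) s.2.1 k) (N' : List ℕ) :
      denWt K r Ω q t (s.1, E', N') = t ^ s.2.1.length * q ^ (posSum 1 s.1 + gapSum K r Ω s.2.1) *
        q ^ (k * gapCount K r (m + 1)) * (q ^ imvOff Ω E' * q ^ invL N') := by
    rw [denWt, length_of_mem_replacements hΩ.ne hE hE', gapSum_of_mem_replacements hΩ.ne hE hE']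
    ring
  rw [Finset.sum_congr rfl fun E' hE' => Finset.sum_congr rfl fun N' _ => key E' hE' N']
  simp only [← Finset.mul_sum, ← Finset.sum_mul]
  rw [h1, h2, denWt]
  ring

lemma stateSum_letter (hΩ : m + 1 < Ω) (hr : 1 ≤ r)
    (h : R.count (m + 1) ≤ K.count (m + 1)) (q t : A) :
    stateSum K R r Ω q t (m + 1) (lowCount K r (m + 1)) e =
      ∑ x ∈ antidiagonal (K.count (m + 1) - R.count (m + 1)),
        q ^ (x.1 * gapCount K r (m + 1)) * replQ q e x.1 *
          completeQ q (gapCount K r (m + 1) + e + x.1) x.2 *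
          stateSum K R r Ω q t m (lowCount K r (m + 1)) (e + x.1) := by
  have hb := lowCount_succ_add_gapCount K hr m
  rw [stateSum, sum_states_succ hΩ rfl (by omega) h]
  refine Finset.sum_congr rfl fun x _ => ?_
  rw [stateSum, Finset.mul_sum]
  exact Finset.sum_congr rfl fun s hs => sum_fillings hΩ (mem_states.1 hs) hb q t

lemma states_succ_eq_empty (hΩ : m + 1 < Ω)
    (h : K.count (m + 1) < R.count (m + 1)) :
    states K R r Ω (m + 1) p e = ∅ := by
  refine Finset.eq_empty_of_forall_notMem fun s hs => ?_
  rw [mem_states] at hs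
  have h1 := Multiset.count_le_of_le (m + 1) (rlMinL_le s.2.2)
  have h2 := congrArg (Multiset.count (m + 1)) hs.content_eq
  rw [hs.rlMin_eq, count_filter_le, if_pos le_rfl] at h1
  rw [Multiset.count_add, Multiset.count_add, count_filter_le, if_pos le_rfl,
    Multiset.count_replicate, if_neg (by omega)] at h2
  omega

end Weights

/-! ### The common expansion of both generating polynomials. -/

section Invariant

open Polynomial

variable {A : Type*} [CommRing A]

/-- The generating polynomials of the states and of the `r`-major index have the same coefficients
with respect to the polynomials `eigenPoly q p j`, up to the factors `elemQ`. -/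
def Matches (K R : Multiset ℕ) (r Ω : ℕ) (q : A) (m p : ℕ) : Prop :=
  ∃ c : ℕ → A, (∀ e, stateSum K R r Ω (C q) X m p e =
      ∑ j ∈ range (p + 1), C (c j) * (elemQ (C q) j e * eigenPoly q p j)) ∧
    majPoly K R r q m = ∑ j ∈ range (p + 1), C (c j) * eigenPoly q p j

lemma matches_open {q : A} (hp : lowCount K r m ≤ p) (hm : m < Ω)
    (h : Matches K R r Ω q m p) : Matches K R r Ω q m (p + 1) := by
  obtain ⟨c, h1, h2⟩ := h
  -- Coefficients with respect to p + 1, read off from P_{p,j} = P_{p+1,j} + q^(p-j) P_{p+1,j+1}.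
  set c' : ℕ → A := fun j => (if j ≤ p then c j else 0) +
    if j = 0 then 0 else q ^ (p + 1 - j) * c (j - 1) with hc'
  have key (F : ℕ → A[X]) : ∑ j ∈ range (p + 1 + 1), C (c' j) * F j =
      ∑ j ∈ range (p + 1), C (c j) * (F j + C q ^ (p - j) * F (j + 1)) := by
    simp only [hc', C_add, add_mul, Finset.sum_add_distrib]
    rw [Finset.sum_range_succ, if_neg (by omega), Finset.sum_range_succ' (n := p + 1), if_pos rfl]
    simp only [map_zero, zero_mul, add_zero, mul_add, Finset.sum_add_distrib]
    congr 1
    · refine Finset.sum_congr rfl fun j hj => ?_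
      rw [if_pos (by simp at hj; omega)]
    · refine Finset.sum_congr rfl fun j hj => ?_
      rw [if_neg (by omega), Nat.add_sub_cancel, Nat.add_sub_add_right, C_mul, C_pow]
      ring
  refine ⟨c', fun e => ?_, ?_⟩
  · rw [key]
    cases e with
    | zero =>
      rw [stateSum_open_zero hp, h1]
      refine Finset.sum_congr rfl fun j hj => ?_
      rw [eigenPoly_eq_add q (by simp at hj; omega : j ≤ p)]
      simp
    | succ e =>
      rw [stateSum_open_succ hp hm, h1, h1, Finset.mul_sum, ← Finset.sum_add_distrib]
      refine Finset.sum_congr rfl fun j hj => ?_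
      have hj' : j ≤ p := by simp at hj; omega
      -- The factor X moves P_{p,j} to P_{p+1,j+1}, where it completes the Pascal rule for `elemQ`
      -- at j + 1.
      have h3 : X * C q ^ (p + 1) * (C (c j) * (elemQ (C q) j e * eigenPoly q p j)) =
          C q ^ (p + 1) * (C (c j) * (elemQ (C q) j e * eigenPoly q (p + 1) (j + 1))) := by
        rw [← X_mul_eigenPoly]; ring
      rw [h3, eigenPoly_eq_add q hj', elemQ_succ, show p + 1 = (p - j) + (j + 1) by omega]
      ring
  · rw [key, h2]
    refine Finset.sum_congr rfl fun j hj => ?_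
    rw [eigenPoly_eq_add q (by simp at hj; omega : j ≤ p)]

/-- Both sides multiply the j-th coefficient by the same scalar: the eigenvalue of the insertion
operator and the value of the q-Vandermonde convolution. -/
lemma matches_letter {q : A} (hr : 1 ≤ r) (hΩ : m + 1 < Ω)
    (h : Matches K R r Ω q m (lowCount K r (m + 1))) :
    Matches K R r Ω q (m + 1) (lowCount K r (m + 1)) := by
  obtain ⟨c, h1, h2⟩ := h
  by_cases hle : R.count (m + 1) ≤ K.count (m + 1)
  · refine ⟨fun j => c j * completeQ q (j + gapCount K r (m + 1))
      (K.count (m + 1) - R.count (m + 1)), fun e => ?_, ?_⟩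
    · rw [stateSum_letter hΩ hr hle]
      simp only [h1, Finset.mul_sum]
      rw [Finset.sum_comm]
      refine Finset.sum_congr rfl fun j _ => ?_
      have h3 := sum_replQ_mul_completeQ_mul_elemQ (C q) j e (gapCount K r (m + 1))
        (K.count (m + 1) - R.count (m + 1))
      rw [C_mul, ← completeQ_C, show ∀ a b c d : A[X], a * b * (c * d) = a * d * (c * b) by
        intros; ring, ← h3, Finset.mul_sum]
      exact Finset.sum_congr rfl fun x _ => by ring
    · rw [majPoly_succ K R hr q m hle, h2, map_sum]
      refine Finset.sum_congr rfl fun j hj => ?_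
      rw [← smul_eq_C_mul, map_smul, insertionOp_eigenPoly _ _ _ _ _ (by simp at hj; omega),
        smul_smul, smul_eq_C_mul]
  · refine ⟨fun _ => 0, fun e => ?_, ?_⟩
    · rw [stateSum, states_succ_eq_empty hΩ (by omega)]
      simp
    · rw [majPoly, wordsLe_succ_eq_empty m (by omega)]
      simp

/-- At the start there is only the empty state and the empty word, or neither when R contains 0. -/
lemma matches_zero {q : A} (hK : 0 ∉ K) (hΩ : 0 < Ω) : Matches K R r Ω q 0 0 := by
  have hK0 : K.filter (· ≤ 0) = 0 := by
    rw [Multiset.filter_eq_nil]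
    intro a ha h
    obtain rfl : a = 0 := by omega
    exact hK ha
  have hst (e) (s) (hs : IsState K R r Ω 0 0 e s) : e = 0 ∧ s = ([], [], []) ∧
      R.filter (· ≤ 0) = 0 := by
    have h1 := List.eq_nil_of_length_eq_zero hs.length_eq
    have h2 := hs.count_eq
    rw [h1] at h2
    have h3 := List.eq_nil_of_length_eq_zero h2.symm
    have h4 := hs.content_eq
    have h5 : e = 0 := by
      have := hs.count_Ω hΩ
      rw [h3] at this
      simpa using this.symm
    rw [h3, hK0, h5] at h4
    have h6 : s.2.2 = [] := by simpa using h4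
    have h7 := hs.rlMin_eq
    rw [h6, rlMinL] at h7
    exact ⟨h5, Prod.ext h1 (Prod.ext h3 h6), h7.symm⟩
  by_cases hR : R.filter (· ≤ 0) = 0
  · refine ⟨fun _ => 1, fun e => ?_, ?_⟩
    · cases e with
      | zero =>
        have : states K R r Ω 0 0 0 = {([], [], [])} := by
          ext s
          rw [mem_states, Finset.mem_singleton]
          refine ⟨fun h => (hst 0 s h).2.1, ?_⟩
          rintro rfl
          exact ⟨rfl, rfl, by rw [hK0]; rfl, by simp, hR.symm, by simp, by simp⟩
        rw [stateSum, this]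
        simp [denWt, posSum, gapSum, imvOff, invL, eigenPoly]
      | succ e =>
        rw [stateSum, Finset.eq_empty_of_forall_notMem (s := states K R r Ω 0 0 (e + 1))]
        · simp
        · intro s hs
          have := (hst _ s (mem_states.1 hs)).1
          omega
    · have : wordsLe K R 0 = {[]} := by
        ext w
        rw [mem_wordsLe, hK0, hR, Finset.mem_singleton]
        constructor
        · rintro ⟨h, -⟩
          simpa using h
        · rintro rfl
          simp [rlMinL]
      rw [majPoly, this]
      simp [majWt, desL, majL, eigenPoly]
  · refine ⟨fun _ => 0, fun e => ?_, ?_⟩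
    · rw [stateSum, Finset.eq_empty_of_forall_notMem (s := states K R r Ω 0 0 e)]
      · simp
      · exact fun s hs => hR (hst _ s (mem_states.1 hs)).2.2
    · rw [majPoly, Finset.eq_empty_of_forall_notMem (s := wordsLe K R 0)]
      · simp
      · intro w hw
        rw [mem_wordsLe, hK0] at hw
        have : w = [] := by simpa using hw.1
        rw [this, rlMinL] at hw
        exact hR hw.2.symm

lemma lowCount_mono (K : Multiset ℕ) (r : ℕ) {x y : ℕ} (h : x ≤ y) :
    lowCount K r x ≤ lowCount K r y :=
  Multiset.card_le_card (Multiset.monotone_filter_right K fun _ _ => by omega)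

/-- Opening positions alternates with inserting letters: the letter m + 1 enters when exactly
`lowCount K r (m + 1)` positions are open. -/
lemma matches_lowCount {q : A} (hr : 1 ≤ r) (hK : 0 ∉ K) (m : ℕ) (hΩ : m < Ω) :
    Matches K R r Ω q m (lowCount K r (m + 1)) := by
  have opening (m : ℕ) (hΩ : m < Ω) (h : Matches K R r Ω q m (lowCount K r m)) :
      Matches K R r Ω q m (lowCount K r (m + 1)) := by
    have hle := lowCount_mono K r (Nat.le_succ m)
    refine Nat.le_induction (P := fun p _ => Matches K R r Ω q m p) h (fun p hp ih => ?_) _ hle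
    exact matches_open hp hΩ ih
  induction m with
  | zero =>
    refine opening 0 hΩ ?_
    have : lowCount K r 0 = 0 := by
      rw [lowCount, Multiset.card_eq_zero, Multiset.filter_eq_nil]
      intro a _ h
      omega
    rw [this]
    exact matches_zero hK hΩ
  | succ m ih => exact opening _ hΩ (matches_letter hr hΩ (ih (by omega)))

lemma stateSum_eq_majPoly {q : A} (hr : 1 ≤ r) (hK : 0 ∉ K) (hΩ : m < Ω) :
    stateSum K R r Ω (C q) X m (lowCount K r (m + 1)) 0 = majPoly K R r q m := by
  obtain ⟨c, h1, h2⟩ := matches_lowCount (R := R) (q := q) hr hK m hΩ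
  rw [h1, h2]
  simp

end Invariant

/-! ### Agreement of the positional statistics with the recursive ones. -/

section Letters

lemma letter_cons_one (x : ℕ) (w : List ℕ) : letter (x :: w) 1 = x := rfl

lemma letter_cons_succ (x : ℕ) (w : List ℕ) (i : ℕ) : letter (x :: w) (i + 2) = letter w (i + 1) :=
  rfl

lemma letter_succ_eq_getElem {w : List ℕ} {i : ℕ} (h : i < w.length) : letter w (i + 1) = w[i] := by
  simp [letter, h]

lemma sum_Icc_one {A : Type*} [AddCommMonoid A] (n : ℕ) (f : ℕ → A) :
    ∑ i ∈ Icc 1 n, f i = ∑ i ∈ range n, f (i + 1) := by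
  rw [Finset.range_eq_Ico, Finset.sum_Ico_add' f 0 n 1]
  rfl

lemma sum_range_letter {A : Type*} [AddCommMonoid A] (w : List ℕ) (f : ℕ → A) :
    ∑ i ∈ range w.length, f (letter w (i + 1)) = (w.map f).sum := by
  induction w with
  | nil => simp
  | cons x w ih =>
    rw [List.length_cons, Finset.sum_range_succ', List.map_cons, List.sum_cons, ← ih, add_comm]
    rfl

lemma sum_ite_eq_countP (w : List ℕ) (p : ℕ → Prop) [DecidablePred p] :
    (w.map fun x => if p x then 1 else 0).sum = w.countP p := by
  induction w with
  | nil => simp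
  | cons x w ih => rw [List.map_cons, List.sum_cons, ih, List.countP_cons, add_comm]; simp

lemma card_filter_letter (w : List ℕ) (p : ℕ → Prop) [DecidablePred p] :
    #{j ∈ Icc 1 w.length | p (letter w j)} = w.countP p := by
  rw [Finset.card_filter, sum_Icc_one, sum_range_letter w fun x => if p x then 1 else 0,
    sum_ite_eq_countP]

lemma card_pairs_cons (P : ℕ → ℕ → Prop) [DecidableRel P] (x : ℕ) (w : List ℕ) :
    #{p ∈ Icc 1 (x :: w).length ×ˢ Icc 1 (x :: w).length |
        p.1 < p.2 ∧ P (letter (x :: w) p.1) (letter (x :: w) p.2)} =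
      w.countP (fun y => P x y) + #{p ∈ Icc 1 w.length ×ˢ Icc 1 w.length |
        p.1 < p.2 ∧ P (letter w p.1) (letter w p.2)} := by
  simp only [Finset.card_filter, Finset.sum_product, sum_Icc_one, List.length_cons]
  rw [Finset.sum_range_succ', add_comm]
  congr 1
  · rw [Finset.sum_range_succ']
    simp only [letter_cons_succ, letter_cons_one, zero_add]
    rw [if_neg (by omega), add_zero, ← sum_ite_eq_countP, ← sum_range_letter]
    refine Finset.sum_congr rfl fun i _ => ?_
    simp
  · refine Finset.sum_congr rfl fun i _ => ?_
    rw [Finset.sum_range_succ', if_neg (by omega), add_zero]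
    refine Finset.sum_congr rfl fun j _ => ?_
    simp only [letter_cons_succ]
    refine if_congr (and_congr_left fun _ => by omega) rfl rfl

lemma inv_eq_invL (w : List ℕ) : inv w = invL w := by
  induction w with
  | nil => rfl
  | cons x w ih =>
    rw [inv, card_pairs_cons (fun a b => a > b), invL, ← ih]
    rfl

lemma imv_eq_imvOff {Ω : ℕ} {w : List ℕ} (h : Ω ∉ w) : imv w = imvOff Ω w := by
  induction w with
  | nil => rfl
  | cons x w ih =>
    rw [imv, card_pairs_cons (fun a b => a ≥ b), imvOff, ← ih fun hmem => h (by simp [hmem])]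
    refine congrArg (· + imv w) (List.countP_congr fun y hy => ?_)
    have : y ≠ Ω := fun h' => h (by simp [← h', hy])
    simp [this]

lemma card_rInv_cons (r x : ℕ) (w : List ℕ) :
    #(rInv r (x :: w)) = w.countP (fun z => z < x ∧ x < z + r) + #(rInv r w) := by
  rw [rInv, card_pairs_cons (fun a b => a > b ∧ b + r > a)]
  rfl

lemma sum_rDes_cons {A : Type*} [AddCommMonoid A] (r x : ℕ) (w : List ℕ) (f : ℕ → A) :
    ∑ i ∈ rDes r (x :: w), f i = headDesc r x w • f 1 + ∑ i ∈ rDes r w, f (i + 1) := by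
  cases w with
  | nil => simp [rDes, headDesc]
  | cons y w =>
    simp only [rDes, Finset.sum_filter, sum_Icc_one, List.length_cons, Nat.add_sub_cancel]
    rw [Finset.sum_range_succ', add_comm]
    congr 1
    simp only [zero_add, letter_cons_one, headDesc]
    rw [show letter (x :: y :: w) (1 + 1) = y from rfl]
    by_cases h : y + r ≤ x <;> simp [h]

lemma rdes_eq_desL (r : ℕ) (w : List ℕ) : rdes r w = desL r w := by
  induction w with
  | nil => rfl
  | cons x w ih =>
    rw [rdes, Finset.card_eq_sum_ones, sum_rDes_cons, desL, ← ih, rdes, Finset.card_eq_sum_ones]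
    simp

lemma rmaj_eq_majL (r : ℕ) (w : List ℕ) : rmaj r w = majL r w := by
  induction w with
  | nil => rfl
  | cons x w ih =>
    rw [rmaj, card_rInv_cons, sum_rDes_cons, majL, ← ih, rmaj, ← rdes_eq_desL, rdes,
      Finset.sum_add_distrib, Finset.sum_const]
    simp only [smul_eq_mul, mul_one]
    omega

lemma Rlwmin_eq_rlMinL (w : List ℕ) : Rlwmin w = rlMinL w := by
  have key (w : List ℕ) : Rlwmin w = ∑ i ∈ range w.length,
      if ∀ j ∈ Ioc (i + 1) w.length, letter w (i + 1) ≤ letter w j then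
        ({letter w (i + 1)} : Multiset ℕ) else 0 := by
    rw [Rlwmin, ← Multiset.sum_map_singleton (Multiset.map _ _), Multiset.map_map]
    change ∑ i ∈ filter _ _, ({letter w i} : Multiset ℕ) = _
    rw [Finset.sum_filter, sum_Icc_one]
  induction w with
  | nil => rfl
  | cons x w ih =>
    rw [key] at ih ⊢
    rw [List.length_cons, Finset.sum_range_succ', rlMinL, ← ih]
    have h1 : (∀ j ∈ Ioc (0 + 1) (w.length + 1),
        letter (x :: w) (0 + 1) ≤ letter (x :: w) j) ↔ ∀ y ∈ w, x ≤ y := by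
      simp only [Finset.mem_Ioc, zero_add, letter_cons_one]
      constructor
      · intro h y hy
        obtain ⟨i, hi, rfl⟩ := List.getElem_of_mem hy
        rw [← letter_succ_eq_getElem hi]
        exact h (i + 2) (by omega)
      · intro h j hj
        obtain ⟨i, rfl⟩ : ∃ i, j = i + 2 := ⟨j - 2, by omega⟩
        rw [letter_cons_succ, letter_succ_eq_getElem (by omega)]
        exact h _ (List.getElem_mem _)
    have h2 (i : ℕ) : (∀ j ∈ Ioc (i + 1 + 1) (w.length + 1),
        letter (x :: w) (i + 1 + 1) ≤ letter (x :: w) j) ↔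
        ∀ j ∈ Ioc (i + 1) w.length, letter w (i + 1) ≤ letter w j := by
      simp only [Finset.mem_Ioc, letter_cons_succ]
      constructor
      · intro h j hj
        have := h (j + 1) (by omega)
        obtain ⟨i, rfl⟩ : ∃ i, j = i + 1 := ⟨j - 1, by omega⟩
        exact this
      · intro h j hj
        obtain ⟨k, rfl⟩ : ∃ k, j = k + 2 := ⟨j - 2, by omega⟩
        exact h (k + 1) (by omega)
    refine (congrArg₂ (· + ·) (Finset.sum_congr rfl fun i _ => if_congr (h2 i) rfl rfl)
      (if_congr h1 rfl rfl)).trans ?_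
    simp only [letter_cons_succ, zero_add, letter_cons_one]
    split_ifs
    · rw [← Multiset.singleton_add, add_comm]
    · rw [add_zero]

end Letters

/-! ### Excedances through the nondecreasing rearrangement. -/

section Rearrangement

lemma length_rearr (w : List ℕ) : (rearr w).length = w.length := by
  rw [rearr, Multiset.length_sort, Multiset.coe_card]

lemma letter_le_iff_of_pairwise {l : List ℕ} (h : l.Pairwise (· ≤ ·)) {i t : ℕ}
    (hi : i < l.length) : letter l (i + 1) ≤ t ↔ i < l.countP (· ≤ t) := by
  induction l generalizing i with
  | nil => simp at hi
  | cons a l ih =>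
    rw [List.pairwise_cons] at h
    rw [List.countP_cons]
    cases i with
    | zero =>
      rw [zero_add, letter_cons_one]
      by_cases hat : a ≤ t
      · simp [hat]
      · have : l.countP (· ≤ t) = 0 :=
          List.countP_eq_zero.2 fun b hb => by have := h.1 b hb; simp; omega
        simp [this, hat]
    | succ i =>
      rw [letter_cons_succ, ih h.2 (by simpa using hi)]
      by_cases hat : a ≤ t
      · simp [hat]
      · have : l.countP (· ≤ t) = 0 :=
          List.countP_eq_zero.2 fun b hb => by have := h.1 b hb; simp; omega
        simp [this, hat]

lemma letter_rearr_le_iff {w : List ℕ} {i t : ℕ} (h1 : 1 ≤ i) (hi : i ≤ w.length) :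
    letter (rearr w) i ≤ t ↔ i ≤ w.countP (· ≤ t) := by
  obtain ⟨i, rfl⟩ : ∃ j, i = j + 1 := ⟨i - 1, by omega⟩
  have h : (rearr w).Pairwise (· ≤ ·) := Multiset.pairwise_sort _ _
  rw [letter_le_iff_of_pairwise h (by rw [length_rearr]; omega), ← Multiset.coe_countP, rearr, Multiset.sort_eq, Multiset.coe_countP]
  omega

lemma lowCount_coe (w : List ℕ) (r x : ℕ) : lowCount w r x = w.countP (fun y => y + r ≤ x) := by
  rw [lowCount, ← Multiset.countP_eq_card_filter, Multiset.coe_countP]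

lemma letter_rearr_add_le_iff {w : List ℕ} {i r x : ℕ} (h1 : 1 ≤ i) (hi : i ≤ w.length) :
    letter (rearr w) i + r ≤ x ↔ i ≤ lowCount w r x := by
  rw [lowCount_coe]
  by_cases h : r ≤ x
  · rw [show (letter (rearr w) i + r ≤ x ↔ letter (rearr w) i ≤ x - r) by omega,
      letter_rearr_le_iff h1 hi]
    have : w.countP (· ≤ x - r) = w.countP (fun y => y + r ≤ x) :=
      List.countP_congr fun y _ => by simp; omega
    rw [this]
  · have : w.countP (fun y => y + r ≤ x) = 0 := List.countP_eq_zero.2 fun y _ => by simp; omega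
    omega

lemma B_eq_gapCount (r : ℕ) (w : List ℕ) (i : ℕ) : B r w i = gapCount w r (letter w i) := by
  rw [B, ← length_rearr w,
    card_filter_letter (rearr w) (fun y => letter w i < y + r ∧ y < letter w i),
    ← Multiset.coe_countP, rearr, Multiset.sort_eq, Multiset.countP_eq_card_filter, gapCount]

/-- The i-th letter of the sorted word is at most t exactly when at least i letters are at most t.
Thus being an excedance depends only on position, letter and content. -/
lemma mem_rExc_iff {r : ℕ} {w : List ℕ} {i : ℕ} :
    i ∈ rExc r w ↔ (1 ≤ i ∧ i ≤ w.length) ∧ i ≤ lowCount w r (letter w i) := by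
  rw [rExc, Finset.mem_filter, Finset.mem_Icc]
  exact and_congr_right fun h => letter_rearr_add_le_iff h.1 h.2

lemma letter_rearr_mono {w : List ℕ} {i j : ℕ} (h1 : 1 ≤ i) (hij : i ≤ j) (hj : j ≤ w.length) :
    letter (rearr w) i ≤ letter (rearr w) j := by
  rw [letter_rearr_le_iff h1 (by omega)]
  exact hij.trans ((letter_rearr_le_iff (by omega) hj).1 le_rfl)

/-- At least i letters are ≤ a_i, only i - 1 positions precede i, and w_i itself exceeds a_i as r ≥
1; so one of them stands after i. Hence an excedance letter is never a weak right-to-left minimum.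
-/
lemma exists_lt_of_mem_rExc {r : ℕ} (hr : 1 ≤ r) {w : List ℕ} {i : ℕ} (h : i ∈ rExc r w) :
    ∃ j, i < j ∧ j ≤ w.length ∧ letter w j < letter w i := by
  rw [rExc, Finset.mem_filter, Finset.mem_Icc] at h
  obtain ⟨⟨h1, h2⟩, h3⟩ := h
  by_contra hcon
  push Not at hcon
  have h4 := (letter_rearr_le_iff h1 h2).1 le_rfl
  have h5 : (w.drop (i - 1)).countP (· ≤ letter (rearr w) i) = 0 := by
    refine List.countP_eq_zero.2 fun y hy => ?_
    obtain ⟨k, hk, rfl⟩ := List.getElem_of_mem hy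
    rw [List.length_drop] at hk
    rw [List.getElem_drop, ← letter_succ_eq_getElem]
    have : letter w i ≤ letter w (i - 1 + k + 1) := by
      rcases Nat.eq_zero_or_pos k with rfl | hk0
      · rw [show i - 1 + 0 + 1 = i by omega]
      · exact hcon _ (by omega) (by omega)
    simp; omega
  have h6 := List.countP_append (p := (· ≤ letter (rearr w) i)) (l₁ := w.take (i - 1))
    (l₂ := w.drop (i - 1))
  rw [List.take_append_drop] at h6
  have h7 := List.countP_le_length (p := (· ≤ letter (rearr w) i)) (l := w.take (i - 1))
  rw [List.length_take] at h7
  omega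

/-- w_i < a_i + r ≤ a_j + r ≤ w_j. -/
lemma letter_lt_of_mem_rExc {r : ℕ} {w : List ℕ} {i j : ℕ} (h1 : 1 ≤ i) (hij : i < j)
    (hi : i ∉ rExc r w) (hj : j ∈ rExc r w) : letter w i < letter w j := by
  rw [rExc, Finset.mem_filter, Finset.mem_Icc] at hi hj
  have := letter_rearr_mono h1 hij.le hj.1.2
  by_contra hcon
  exact hi ⟨⟨h1, by omega⟩, by omega⟩

end Rearrangement

/-! ### Marked words as shuffles of two subsequences. -/

section Unpair

/-- The marks of a marked word, its letters marked `true`, and its letters marked `false`. -/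
def unpair (L : List (Bool × ℕ)) : List Bool × List ℕ × List ℕ :=
  (L.map Prod.fst, (L.filter (fun z => z.1)).map Prod.snd,
    (L.filter (fun z => !z.1)).map Prod.snd)

lemma unpair_cons_true (x : ℕ) (L : List (Bool × ℕ)) :
    unpair ((true, x) :: L) =
      (true :: (unpair L).1, x :: (unpair L).2.1, (unpair L).2.2) := by
  simp [unpair]

lemma unpair_cons_false (x : ℕ) (L : List (Bool × ℕ)) :
    unpair ((false, x) :: L) =
      (false :: (unpair L).1, (unpair L).2.1, x :: (unpair L).2.2) := by
  simp [unpair]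

lemma unpair_injective : Function.Injective unpair := by
  intro L L' h
  induction L generalizing L' with
  | nil =>
    have := congrArg Prod.fst h
    simpa [unpair] using this.symm
  | cons z L ih =>
    cases L' with
    | nil =>
      have := congrArg Prod.fst h
      simp [unpair] at this
    | cons z' L' =>
      obtain ⟨b, x⟩ := z
      obtain ⟨b', x'⟩ := z'
      cases b <;> cases b' <;>
        simp only [unpair_cons_true, unpair_cons_false, Prod.mk.injEq, List.cons.injEq,
          reduceCtorEq, false_and] at h
      · rw [h.2.2.1, ih (Prod.ext h.1.2 (Prod.ext h.2.1 h.2.2.2))]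
      · rw [h.2.1.1, ih (Prod.ext h.1.2 (Prod.ext h.2.1.2 h.2.2))]

lemma exists_unpair_eq (β : List Bool) (E N : List ℕ) (hE : β.count true = E.length)
    (hN : β.count false = N.length) : ∃ L, unpair L = (β, E, N) := by
  induction β generalizing E N with
  | nil =>
    refine ⟨[], ?_⟩
    rw [List.eq_nil_of_length_eq_zero hE.symm, List.eq_nil_of_length_eq_zero hN.symm]
    rfl
  | cons b β ih =>
    cases b with
    | true =>
      cases E with
      | nil => simp at hE
      | cons x E =>
        obtain ⟨L, hL⟩ := ih E N (by simpa using hE) (by simpa using hN)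
        exact ⟨(true, x) :: L, by rw [unpair_cons_true, hL]⟩
    | false =>
      cases N with
      | nil => simp at hN
      | cons x N =>
        obtain ⟨L, hL⟩ := ih E N (by simpa using hE) (by simpa using hN)
        exact ⟨(false, x) :: L, by rw [unpair_cons_false, hL]⟩

lemma count_true_unpair (L : List (Bool × ℕ)) :
    (unpair L).1.count true = (unpair L).2.1.length := by
  induction L with
  | nil => rfl
  | cons z L ih =>
    obtain ⟨b, x⟩ := z
    cases b
    · simpa [unpair_cons_false] using ih
    · simpa [unpair_cons_true] using ih

lemma drop_unpair (L : List (Bool × ℕ)) (k : ℕ) :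
    (unpair L).2.1.drop (((unpair L).1.take k).count true) = (unpair (L.drop k)).2.1 := by
  induction L generalizing k with
  | nil => simp [unpair]
  | cons z L ih =>
    obtain ⟨b, x⟩ := z
    cases k with
    | zero => simp
    | succ k =>
      rw [List.drop_succ_cons, ← ih]
      cases b
      · simp [unpair_cons_false]
      · simp [unpair_cons_true]

lemma take_unpair (L : List (Bool × ℕ)) (k : ℕ) :
    (unpair L).2.2.take (((unpair L).1.take k).count false) = (unpair (L.take k)).2.2 := by
  induction L generalizing k with
  | nil => simp [unpair]
  | cons z L ih =>
    obtain ⟨b, x⟩ := z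
    cases k with
    | zero => simp [unpair]
    | succ k =>
      rw [List.take_succ_cons]
      cases b
      · simp [unpair_cons_false, ih]
      · simp [unpair_cons_true, ih]

lemma coe_unpair_add (L : List (Bool × ℕ)) :
    ((unpair L).2.1 : Multiset ℕ) + ((unpair L).2.2 : Multiset ℕ) = (L.map Prod.snd : List ℕ) := by
  rw [unpair, Multiset.coe_add, ← List.map_append, Multiset.coe_eq_coe]
  exact (List.filter_append_perm _ L).map _

lemma mem_unpair_true {L : List (Bool × ℕ)} {y : ℕ} : y ∈ (unpair L).2.1 ↔ (true, y) ∈ L := by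
  simp [unpair]

lemma mem_unpair_false {L : List (Bool × ℕ)} {y : ℕ} : y ∈ (unpair L).2.2 ↔ (false, y) ∈ L := by
  simp [unpair]

end Unpair

/-! ### Words as complete states, and the equidistribution. -/

section ExcPairs

/-- The letters of `w`, each with a mark that tells whether its position is an `r`-excedance. -/
def excPairs (r : ℕ) (w : List ℕ) : List (Bool × ℕ) :=
  (List.range' 1 w.length).map fun i => (decide (i ∈ rExc r w), letter w i)

lemma length_excPairs (r : ℕ) (w : List ℕ) : (excPairs r w).length = w.length := by
  simp [excPairs]

lemma getElem_excPairs (r : ℕ) (w : List ℕ) (i : ℕ) (h : i < (excPairs r w).length) :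
    (excPairs r w)[i] = (decide (i + 1 ∈ rExc r w), letter w (i + 1)) := by
  simp [excPairs, add_comm]

lemma map_snd_excPairs (r : ℕ) (w : List ℕ) : (excPairs r w).map Prod.snd = w := by
  refine List.ext_getElem (by simp [excPairs]) fun i h1 h2 => ?_
  rw [List.getElem_map, getElem_excPairs, letter_succ_eq_getElem h2]

lemma unpair_excPairs (r : ℕ) (w : List ℕ) :
    unpair (excPairs r w) = ((List.range' 1 w.length).map (fun i => decide (i ∈ rExc r w)),
      rEXCL r w, rNEXCL r w) := by
  simp only [unpair, excPairs, rEXCL, rNEXCL, List.map_map, List.filter_map, Prod.mk.injEq]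
  refine ⟨rfl, rfl, ?_⟩
  rw [List.filter_congr (q := fun i => decide (i ∉ rExc r w))]
  · rfl
  · intro i _
    simp

lemma filter_range'_toFinset (r : ℕ) (w : List ℕ) :
    ((List.range' 1 w.length).filter (fun i => i ∈ rExc r w)).toFinset = rExc r w := by
  ext i
  simp only [List.mem_toFinset, List.mem_filter, List.mem_range'_1, decide_eq_true_eq,
    and_iff_right_iff_imp]
  intro h
  have := (mem_rExc_iff.1 h).1
  omega

lemma sum_rExc {A : Type*} [AddCommMonoid A] (r : ℕ) (w : List ℕ) (f : ℕ → A) :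
    ∑ i ∈ rExc r w, f i =
      (((List.range' 1 w.length).filter (fun i => i ∈ rExc r w)).map f).sum := by
  rw [← List.sum_toFinset f (List.Nodup.filter _ List.nodup_range'), filter_range'_toFinset]

lemma rexc_eq_length (r : ℕ) (w : List ℕ) : rexc r w = (rEXCL r w).length := by
  rw [rexc, Finset.card_eq_sum_ones, sum_rExc, rEXCL]
  simp

lemma posSum_map_range' (s n : ℕ) (p : ℕ → Prop) [DecidablePred p] :
    posSum s ((List.range' s n).map fun i => decide (p i)) =
      ((List.range' s n).filter (fun i => p i)).sum := by
  induction n generalizing s with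
  | zero => rfl
  | succ n ih =>
    rw [List.range'_succ, List.map_cons, posSum, ih]
    by_cases h : p s <;> simp [h]

lemma mem_rEXCL {r : ℕ} {w : List ℕ} {y : ℕ} (h : y ∈ rEXCL r w) : y ∈ w := by
  have h2 : (unpair (excPairs r w)).2.1 = rEXCL r w := by rw [unpair_excPairs]
  rw [← h2, mem_unpair_true] at h
  rw [← map_snd_excPairs r w]
  exact List.mem_map_of_mem (f := Prod.snd) h

lemma denWt_unpair_excPairs {A : Type*} [CommRing A] (q t : A) {r Ω : ℕ} {w : List ℕ}
    (hΩ : Ω ∉ w) :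
    denWt w r Ω q t (unpair (excPairs r w)) = t ^ rexc r w * q ^ rden r w := by
  rw [unpair_excPairs, denWt, rexc_eq_length, rden,
    imv_eq_imvOff (Ω := Ω) (fun h => hΩ (mem_rEXCL h)), inv_eq_invL, posSum_map_range',
    Finset.sum_add_distrib]
  have h1 : ∑ i ∈ rExc r w, i =
      ((List.range' 1 w.length).filter (fun i => i ∈ rExc r w)).sum := by
    rw [sum_rExc r w fun i => i, List.map_id']
  have h2 : ∑ i ∈ rExc r w, B r w i = gapSum w r Ω (rEXCL r w) := by
    rw [sum_rExc, gapSum, rEXCL, List.map_map]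
    congr 1
    refine List.map_congr_left fun i hi => ?_
    have hy : letter w i ∈ w := mem_rEXCL (r := r) (List.mem_map_of_mem (f := letter w) hi)
    rw [Function.comp, B_eq_gapCount, if_neg]
    exact fun h => hΩ (h ▸ hy)
  rw [h1, h2]

/-- By `h1` the positions satisfying p carry no minimum, and by `h2` they never prevent an earlier
position from carrying one, so they may be dropped. -/
lemma rlMinL_map_filter (f : ℕ → ℕ) (p : ℕ → Prop) [DecidablePred p] (s n : ℕ)
    (h1 : ∀ i, s ≤ i → i < s + n → p i → ∃ j, i < j ∧ j < s + n ∧ f j < f i)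
    (h2 : ∀ i j, s ≤ i → i < j → j < s + n → ¬ p i → p j → f i ≤ f j) :
    rlMinL ((List.range' s n).map f) =
      rlMinL (((List.range' s n).filter (fun i => ¬ p i)).map f) := by
  induction n generalizing s with
  | zero => rfl
  | succ n ih =>
    have ih' := ih (s + 1)
      (fun i hi hi' hp => by
        obtain ⟨j, hj⟩ := h1 i (by omega) (by omega) hp
        exact ⟨j, by omega, by omega, hj.2.2⟩)
      (fun i j hi hij hj => h2 i j (by omega) hij (by omega))
    rw [List.range'_succ, List.map_cons, rlMinL, ih']
    by_cases hp : p s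
    · rw [List.filter_cons_of_neg (by simpa using hp), if_neg]
      intro hcon
      obtain ⟨j, hj1, hj2, hj3⟩ := h1 s le_rfl (by omega) hp
      have := hcon (f j) (List.mem_map_of_mem (by rw [List.mem_range'_1]; omega))
      omega
    · rw [List.filter_cons_of_pos (by simpa using hp), List.map_cons, rlMinL]
      refine if_congr ?_ rfl rfl
      simp only [List.mem_map, List.mem_filter, List.mem_range'_1, forall_exists_index, and_imp,
        decide_eq_true_eq]
      constructor
      · exact fun h y i hi hi' _ he => h y i hi hi' he
      · rintro h y i hi hi' rfl
        by_cases hpi : p i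
        · exact h2 s i le_rfl (by omega) (by omega) hp hpi
        · exact h _ i hi hi' hpi rfl

lemma rlMinL_rNEXCL {r : ℕ} (hr : 1 ≤ r) (w : List ℕ) : rlMinL (rNEXCL r w) = rlMinL w := by
  have hw : (List.range' 1 w.length).map (letter w) = w := by
    conv_rhs => rw [← map_snd_excPairs r w, excPairs, List.map_map]
    rfl
  conv_rhs => rw [← hw]
  rw [rlMinL_map_filter (letter w) (fun i => i ∈ rExc r w), rNEXCL]
  · intro i _ _ hp
    obtain ⟨j, h1, h2, h3⟩ := exists_lt_of_mem_rExc hr hp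
    exact ⟨j, h1, by omega, h3⟩
  · intro i j hi hij _ hp hp'
    exact (letter_lt_of_mem_rExc hi hij hp hp').le

variable {R : Multiset ℕ} {r Ω m : ℕ} {w : List ℕ}

lemma isState_unpair_excPairs (hr : 1 ≤ r) (hw : ∀ x ∈ w, x ≤ m)
    (hR : R.filter (· ≤ m) = R) (hΩ : m < Ω) (h : rlMinL w = R) :
    IsState w R r Ω m w.length 0 (unpair (excPairs r w)) := by
  have hcoe : ((unpair (excPairs r w)).2.1 : Multiset ℕ) + ((unpair (excPairs r w)).2.2) = w := by
    rw [coe_unpair_add, map_snd_excPairs]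
  have hfil : (w : Multiset ℕ).filter (· ≤ m) = w := Multiset.filter_eq_self.2 hw
  refine ⟨by simp [unpair, excPairs], count_true_unpair _, by rw [hcoe, hfil]; simp, ?_, ?_, ?_, ?_⟩
  · intro hmem
    have : Ω ∈ (w : Multiset ℕ) := by
      rw [← hcoe]; exact Multiset.mem_add.2 (Or.inr hmem)
    have := hw Ω this
    omega
  · rw [unpair_excPairs, rlMinL_rNEXCL hr, h, hR]
  · intro x _ y hy
    rw [drop_unpair, mem_unpair_true] at hy
    obtain ⟨i, hi, hiy⟩ := List.getElem_of_mem hy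
    rw [List.getElem_drop, getElem_excPairs, Prod.mk.injEq, decide_eq_true_eq, rExc,
      Finset.mem_filter, Finset.mem_Icc] at hiy
    obtain ⟨⟨h1, h2⟩, rfl⟩ := hiy
    by_contra hcon
    have := (letter_rearr_add_le_iff (r := r) (x := x) h1.1 h1.2).1 (by omega)
    omega
  · intro x _ y hy
    rw [take_unpair, mem_unpair_false] at hy
    obtain ⟨i, hi, hiy⟩ := List.getElem_of_mem hy
    rw [List.length_take, length_excPairs] at hi
    rw [List.getElem_take, getElem_excPairs, Prod.mk.injEq, decide_eq_false_iff_not, rExc,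
      Finset.mem_filter, Finset.mem_Icc] at hiy
    obtain ⟨h1, rfl⟩ := hiy
    by_contra hcon
    have := (letter_rearr_add_le_iff (w := w) (i := i + 1) (r := r) (x := x) (by omega)
      (by omega)).2 (by omega)
    exact h1 ⟨by omega, by omega⟩

/-- The marks and the two words interleave to a word of content K. The point is that its excedances
are exactly the marked positions. -/
lemma exists_excPairs_of_isState {K : Multiset ℕ} {s : List Bool × List ℕ × List ℕ} (hr : 1 ≤ r)
    (hK : K.filter (· ≤ m) = K) (hR : R.filter (· ≤ m) = R)
    (h : IsState K R r Ω m K.card 0 s) :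
    ∃ w : List ℕ, (w : Multiset ℕ) = K ∧ rlMinL w = R ∧ unpair (excPairs r w) = s := by
  obtain ⟨L, hL⟩ := exists_unpair_eq s.1 s.2.1 s.2.2 h.count_eq (by
    have h1 := h.count_false
    have h2 := h.length_add_length
    rw [hK] at h2
    omega)
  replace hL : unpair L = s := hL
  subst hL
  have hw : ((L.map Prod.snd : List ℕ) : Multiset ℕ) = K := by
    rw [← coe_unpair_add, h.content_eq, hK]; simp
  have hlen : (L.map Prod.snd).length = L.length := by simp
  have hLe : excPairs r (L.map Prod.snd) = L := by
    refine List.ext_getElem (by rw [length_excPairs, hlen]) fun i h1 h2 => ?_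
    have hlet : letter (L.map Prod.snd) (i + 1) = L[i].2 := by
      rw [letter_succ_eq_getElem (by rw [hlen]; exact h2), List.getElem_map]
    rw [getElem_excPairs]
    refine Prod.ext ?_ hlet
    have hmem : L[i].2 ≤ m := by
      have : L[i].2 ∈ K.filter (· ≤ m) := by
        rw [hK, ← hw]
        exact List.mem_map_of_mem (f := Prod.snd) (List.getElem_mem h2)
      exact (Multiset.mem_filter.1 this).2
    have hiff : i + 1 ∈ rExc r (L.map Prod.snd) ↔ i < lowCount K r L[i].2 := by
      rw [mem_rExc_iff, hlet, hw, hlen]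
      omega
    simp only [hiff]
    cases hb : L[i].1 with
    | true =>
      rw [decide_eq_true_eq]
      by_contra hcon
      -- The state condition with x the letter itself would give x < x.
      have := h.lt_of_mem_drop L[i].2 hmem L[i].2
      rw [drop_unpair, mem_unpair_true] at this
      refine lt_irrefl _ (this ?_)
      rw [List.mem_iff_getElem]
      refine ⟨i - lowCount K r L[i].2, by rw [List.length_drop]; omega, ?_⟩
      rw [List.getElem_drop, getElem_congr_idx (Nat.add_sub_of_le (not_lt.1 hcon))]
      exact Prod.ext hb rfl
    | false =>
      rw [decide_eq_false_iff_not]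
      intro hcon
      have := h.lt_of_mem_take L[i].2 hmem L[i].2
      rw [take_unpair, mem_unpair_false] at this
      refine lt_irrefl _ (this ?_)
      rw [List.mem_iff_getElem]
      refine ⟨i, by rw [List.length_take]; omega, ?_⟩
      rw [List.getElem_take]
      exact Prod.ext hb rfl
  refine ⟨L.map Prod.snd, hw, ?_, by rw [hLe]⟩
  have h1 := h.rlMin_eq
  rw [← hLe, unpair_excPairs, rlMinL_rNEXCL hr, hR] at h1
  exact h1

/-- The generating function of the states with all positions filled is the generating function of
the `r`-excedance number and the `r`-gap Denert statistic. -/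
lemma sum_excedance_eq_stateSum {A : Type*} [CommRing A] (q t : A) {K : Multiset ℕ} (hr : 1 ≤ r)
    (hK : K.filter (· ≤ m) = K) (hR : R.filter (· ≤ m) = R) (hΩ : m < Ω) :
    ∑ w ∈ wordsLe K R m, t ^ rexc r w * q ^ rden r w =
      stateSum K R r Ω q t m K.card 0 := by
  have hle (w) (hw : (w : Multiset ℕ) = K) : ∀ x ∈ w, x ≤ m := fun x hx => by
    have : x ∈ K.filter (· ≤ m) := by rw [hK, ← hw]; exact hx
    exact (Multiset.mem_filter.1 this).2
  refine Finset.sum_bij (fun w _ => unpair (excPairs r w)) ?_ ?_ ?_ ?_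
  · intro w hw
    rw [mem_wordsLe, hK, hR] at hw
    obtain ⟨rfl, hw2⟩ := hw
    rw [mem_states]
    exact isState_unpair_excPairs hr (hle w rfl) hR hΩ hw2
  · intro w _ w' _ h
    rw [← map_snd_excPairs r w, ← map_snd_excPairs r w', unpair_injective h]
  · intro s hs
    obtain ⟨w, h1, h2, h3⟩ := exists_excPairs_of_isState hr hK hR (mem_states.1 hs)
    exact ⟨w, by rw [mem_wordsLe, hK, hR]; exact ⟨h1, h2⟩, h3⟩
  · intro w hw
    rw [mem_wordsLe, hK] at hw
    obtain ⟨rfl, -⟩ := hw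
    rw [denWt_unpair_excPairs]
    intro hmem
    have := hle w rfl _ hmem
    omega

open Polynomial in
/-- Equidistribution of the two pairs of statistics on the rearrangements of a multiset of positive
integers with prescribed weak right-to-left minima. -/
lemma equidistribution {K : Multiset ℕ} (hK0 : 0 ∉ K) (R : Multiset ℕ) (hr : 1 ≤ r)
    {A : Type*} [CommRing A] (q t : A) {W : Finset (List ℕ)}
    (hW : ∀ w, w ∈ W ↔ (w : Multiset ℕ) = K ∧ Rlwmin w = R) :
    ∑ w ∈ W, t ^ rdes r w * q ^ rmaj r w = ∑ w ∈ W, t ^ rexc r w * q ^ rden r w := by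
  -- Large enough to bound all letters of K and R, and to have x + r ≤ m for every letter x of K, so
  -- that all positions are open at the end.
  set m := K.sum + R.sum + r with hm
  have hKm : ∀ x ∈ K, x + r ≤ m := fun x hx => by have := Multiset.le_sum_of_mem hx; omega
  have hK : K.filter (· ≤ m) = K :=
    Multiset.filter_eq_self.2 fun x hx => by have := hKm x hx; omega
  have hR : R.filter (· ≤ m) = R :=
    Multiset.filter_eq_self.2 fun x hx => by have := Multiset.le_sum_of_mem hx; omega
  have hlow : lowCount K r (m + 1) = K.card := by
    rw [lowCount, Multiset.filter_eq_self.2 fun x hx => by have := hKm x hx; omega]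
  have hWm : W = wordsLe K R m := by
    ext w
    rw [hW, mem_wordsLe, hK, hR, Rlwmin_eq_rlMinL]
  rw [hWm]
  -- The identity is taken in ℤ[q][t] with both variables free, and then evaluated at the given q
  -- and t.
  have key := stateSum_eq_majPoly (q := (X : ℤ[X])) (R := R) hr hK0 (Nat.lt_succ_self m)
  rw [hlow, ← sum_excedance_eq_stateSum _ _ hr hK hR (Nat.lt_succ_self m), majPoly] at key
  have := congrArg (eval₂RingHom (eval₂RingHom (Int.castRingHom A) q) t) key
  simp only [map_sum, map_mul, map_pow, coe_eval₂RingHom, eval₂_X, eval₂_C, majWt] at this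
  rw [this]
  exact Finset.sum_congr rfl fun w _ => by rw [rdes_eq_desL, rmaj_eq_majL]

lemma mem_wordsRlwmin {n : ℕ} {α : Composition n} {R : Multiset ℕ} {w : List ℕ} :
    w ∈ wordsRlwmin α R ↔ (w : Multiset ℕ) = content α ∧ Rlwmin w = R := by
  rw [wordsRlwmin, Finset.mem_filter, words, Multiset.mem_toFinset, Multiset.mem_lists_iff]
  exact and_congr_left fun _ => eq_comm

lemma zero_notMem_content {n : ℕ} (α : Composition n) : 0 ∉ content α := by
  simp [content, Multiset.mem_sum, Multiset.mem_replicate]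

end ExcPairs

end RWord

theorem theorem2p3 (n : ℕ) (hn : 0 < n) (α : Composition n) (R : Multiset ℕ)
    (r : ℕ) (hr : 1 ≤ r) :
    (∑ w ∈ RWord.wordsRlwmin α R,
        (MvPolynomial.X 0 ^ RWord.rdes r w * MvPolynomial.X 1 ^ RWord.rmaj r w :
          MvPolynomial (Fin 2) ℤ)) =
      ∑ w ∈ RWord.wordsRlwmin α R,
        (MvPolynomial.X 0 ^ RWord.rexc r w * MvPolynomial.X 1 ^ RWord.rden r w :
          MvPolynomial (Fin 2) ℤ) :=
  RWord.equidistribution (RWord.zero_notMem_content α) R hr _ _ fun _ => RWord.mem_wordsRlwmin
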